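/- Let $\mathcal{M}=(M,\mathcal{S})$ be a countable model of $\mathsf{RCA}_0$ (both the first-order part $M$ and the family $\mathcal{S}\subseteq\mathcal{P}(M)$ are countable), and let $C\subseteq M$ be an arbitrary set. Then there is a set $B\subseteq M$ such that $\mathcal{M}[B]\models\mathsf{RCA}_0$ and $C$ is $\Delta_2(B)$; in fact, $C$ is $\Delta_1(B')$. Here $\mathsf{RCA}_0$ consists of the basic axioms $P^-$ of arithmetic (the axioms of the nonnegative part of a discretely ordered commutative ring), induction for $\Sigma^0_1$ formulas and $\Delta^0_1$ comprehension, the last two with number parameters from $M$ and set parameters from $\mathcal{S}$. The model $\mathcal{M}[B]$ is $(M,\mathcal{S}^*)$, where $\mathcal{S}^*$ is the closure of $\mathcal{S}\cup\{B\}$ under join and $\Delta^0_1$ comprehension. A set is $\Delta_n(A)$ if both it and its complement are definable by $\Sigma_n$ formulas with number parameters from $M$ and with $A$ as the only set parameter. The jump of $B$ is $B'=\{e\in M:\Phi^B(e,e)\text{ is defined}\}$, where $\Phi^Z(e,x)$ is the standard universal $\Sigma_1$ partial function with oracle $Z$, interpreted in $M$ (so a computation is coded by an element of $M$, possibly a nonstandard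 one). -/

import Mathlib

namespace SecondOrderArith

/-- The axiom system `P⁻` (the nonnegative part of a discretely ordered commutative ring), on top
of the commutative semiring axioms and the axioms of a linear order: addition and multiplication
are strictly monotone, `x ≤ y` holds iff `y = x + z` for some `z`, and there is nothing strictly
between `0` and `1`. -/
class PMinus (M : Type*) [CommSemiring M] [LinearOrder M] : Prop
    extends IsStrictOrderedRing M, CanonicallyOrderedAdd M where
  one_le_of_pos : ∀ x : M, 0 < x → 1 ≤ x

/-- Number terms in the language `0, 1, +, ·`; number variables are de Bruijn indices. -/
inductive NTerm : Type
  | var : ℕ → NTerm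
  | zero : NTerm
  | one : NTerm
  | add : NTerm → NTerm → NTerm
  | mul : NTerm → NTerm → NTerm

/-- Bounded (`Σ₀`) formulas with `k` free set variables. In `ball t φ`, which is `∀ x < t, φ`, the
new variable has index `0` in `φ`, and `t` does not contain it. -/
inductive Form0 (k : ℕ) : Type
  | eq : NTerm → NTerm → Form0 k
  | lt : NTerm → NTerm → Form0 k
  | mem : NTerm → Fin k → Form0 k
  | neg : Form0 k → Form0 k
  | and : Form0 k → Form0 k → Form0 k
  | ball : NTerm → Form0 k → Form0 k

section Semantics

variable {M : Type*}

/-- The assignment `x, v 0, v 1, …`. -/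
def push (x : M) (v : ℕ → M) : ℕ → M
  | 0 => x
  | i + 1 => v i

variable [CommSemiring M] [LinearOrder M]

def NTerm.val (v : ℕ → M) : NTerm → M
  | .var i => v i
  | .zero => 0
  | .one => 1
  | .add s t => s.val v + t.val v
  | .mul s t => s.val v * t.val v

/-- Truth of a bounded formula; the set variables are interpreted by `Z`, the number variables
by `v`. -/
def Form0.Sat {k : ℕ} (Z : Fin k → Set M) : (ℕ → M) → Form0 k → Prop
  | v, .eq s t => s.val v = t.val v
  | v, .lt s t => s.val v < t.val v
  | v, .mem t i => t.val v ∈ Z i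
  | v, .neg φ => ¬ φ.Sat Z v
  | v, .and φ ψ => φ.Sat Z v ∧ ψ.Sat Z v
  | v, .ball t φ => ∀ x : M, x < t.val v → φ.Sat Z (push x v)

/-- Truth of the `Σₙ` formula with matrix `φ`, that is, of `∃ y₁ ¬ ∃ y₂ ¬ … ∃ yₙ (¬) φ`, which is
`∃ y₁ ∀ y₂ ∃ y₃ …` in front of `φ` or of its negation. -/
def SigmaSat {k : ℕ} (Z : Fin k → Set M) (φ : Form0 k) : ℕ → (ℕ → M) → Prop
  | 0, v => φ.Sat Z v
  | n + 1, v => ∃ y : M, ¬ SigmaSat Z φ n (push y v)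

/-- `X` is `Σₙ` definable with number parameters from `M` (supplied by the assignment `v`) and the
set parameters `Z`. -/
def IsSigma {k : ℕ} (n : ℕ) (Z : Fin k → Set M) (X : Set M) : Prop :=
  ∃ (φ : Form0 k) (v : ℕ → M), ∀ x : M, x ∈ X ↔ SigmaSat Z φ n (push x v)

/-- `X` is `Δₙ` definable with number parameters from `M` and the set parameters `Z`. -/
def IsDelta {k : ℕ} (n : ℕ) (Z : Fin k → Set M) (X : Set M) : Prop :=
  IsSigma n Z X ∧ IsSigma n Z Xᶜ

/-- `X` is a `Δₙ(A)` set: number parameters from `M` and the single set parameter `A`. -/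
def IsDeltaIn (n : ℕ) (A X : Set M) : Prop :=
  IsDelta n (fun _ : Fin 1 => A) X

/-- `(M, S) ⊨ RCA₀`, where `M ⊨ P⁻`: induction for `Σ⁰₁` formulas and `Δ⁰₁` comprehension, both
with number parameters from `M` and any finite number of set parameters from `S`. -/
structure RCA0 [PMinus M] (S : Set (Set M)) : Prop where
  induction : ∀ (k : ℕ) (Z : Fin k → Set M), (∀ i, Z i ∈ S) → ∀ X : Set M, IsSigma 1 Z X →
    0 ∈ X → (∀ x ∈ X, x + 1 ∈ X) → ∀ x : M, x ∈ X
  comprehension : ∀ (k : ℕ) (Z : Fin k → Set M), (∀ i, Z i ∈ S) → ∀ X : Set M,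
    IsDelta 1 Z X → X ∈ S

/-- The join `A ⊕ B`. -/
def join (A B : Set M) : Set M :=
  {x | (∃ a ∈ A, x = 2 * a) ∨ (∃ b ∈ B, x = 2 * b + 1)}

/-- The second-order part of `M[G]`, where `M = (M, S)`: the closure of `S ∪ {G}` under join and
`Δ⁰₁` comprehension. -/
inductive Ext (S : Set (Set M)) (G : Set M) : Set M → Prop
  | base (A : Set M) : A ∈ S → Ext S G A
  | gen : Ext S G G
  | join (A B : Set M) : Ext S G A → Ext S G B → Ext S G (join A B)
  | delta (A X : Set M) : Ext S G A → IsDeltaIn 1 A X → Ext S G X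

def ext (S : Set (Set M)) (G : Set M) : Set (Set M) := {A | Ext S G A}

/-- The quadratic pairing function. -/
def pair (x y : M) : M := (x + y) * (x + y) + x

/-- The finite set in the sense of `M` that is coded by `a, b, n`, by Gödel's method. In a model
of `Σ₁` induction the sets of this form are exactly the bounded `Δ₁` sets. -/
def codedSet (a b n : M) : Set M := {x | x < n ∧ (1 + (x + 1) * b) ∣ a}

/-- The triple `⟨e, x, y⟩` is in `T`, to be read as: program `e` on input `x` has output `y`. -/
def Rec (T : Set M) (e x y : M) : Prop := pair e (pair x y) ∈ T

/-- The claim that program `e` on input `x` has output `y` follows, with oracle `A`, from the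
claims recorded in `T`. A program is a number `⟨tag, data⟩`, and a number without such a form is a
program that never halts. The programs are: constants, identity, the two projections of a pair,
addition, multiplication and comparison of the two components of a pair, the oracle, pairing
`x ↦ ⟨f x, g x⟩`, composition `f ∘ g`, and the least number operator
`x ↦ μ y. f ⟨x, y⟩ = 0` (where `f ⟨x, z⟩` has to be defined for all `z < y`). -/
def Justified (A T : Set M) (e x y : M) : Prop :=
  (∃ c, e = pair 0 c ∧ y = c) ∨
  (e = pair 1 0 ∧ y = x) ∨
  (e = pair 2 0 ∧ ∃ b, x = pair y b) ∨
  (e = pair 3 0 ∧ ∃ a, x = pair a y) ∨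
  (e = pair 4 0 ∧ ∃ a b, x = pair a b ∧ y = a + b) ∨
  (e = pair 5 0 ∧ ∃ a b, x = pair a b ∧ y = a * b) ∨
  (e = pair 6 0 ∧ ∃ a b, x = pair a b ∧ ((a < b ∧ y = 1) ∨ (b ≤ a ∧ y = 0))) ∨
  (e = pair 7 0 ∧ ((x ∈ A ∧ y = 1) ∨ (x ∉ A ∧ y = 0))) ∨
  (∃ f g, e = pair 8 (pair f g) ∧ ∃ u w, Rec T f x u ∧ Rec T g x w ∧ y = pair u w) ∨
  (∃ f g, e = pair 9 (pair f g) ∧ ∃ u, Rec T g x u ∧ Rec T f u y) ∨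
  (∃ f, e = pair 10 f ∧ Rec T f (pair x y) 0 ∧
    ∀ z, z < y → ∃ w, w ≠ 0 ∧ Rec T f (pair x z) w)

/-- `Φ^A(e, x) = y`, for the universal `Σ₁` partial function `Φ`: there is a finite set (in the
sense of `M`) of computation records that contains `⟨e, x, y⟩` and in which every record is
justified. Justification refers only to records of smaller programs, so the value is unique in
a model of `Σ₁(A)` induction. -/
def Computes (A : Set M) (e x y : M) : Prop :=
  ∃ a b n : M, Rec (codedSet a b n) e x y ∧
    ∀ e' x' y', Rec (codedSet a b n) e' x' y' → Justified A (codedSet a b n) e' x' y'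

/-- The jump `A' = {e : Φ^A(e, e) is defined}`. -/
def jump (A : Set M) : Set M := {e | ∃ y, Computes A e e y}

end Semantics

end SecondOrderArith

set_option linter.unusedSectionVars false

namespace SecondOrderArith

section

-- Let `D = join C Cᶜ`. The set `B` is generic with `D` as its pointwise limit: each column `s ↦ ⟨x,
-- s⟩` is eventually constant with value the truth of `x ∈ D`. Then `x ∈ D` iff `∃ s₀ ∀ s ≥ s₀, ⟨x,
-- s⟩ ∈ B`, which is `Σ₂(B)`; since `D` contains both `C` and its complement, this gives `Δ₂(B)`.
-- The inner universal statement says that a search for a counterexample never halts, so `D` is also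
-- `Σ₁` in the jump.
--
-- A condition is a partial function in the model whose columns are each open almost everywhere or
-- settled as `D` requires. Settling one more column uses a single bit of `D`, so the condition
-- stays in `S` however complicated `D` is (`Condition.exists_le_column`). Instances of `Σ₁`
-- induction for `B` are met by finite extensions, using `Σ₁` induction in the ground model
-- (`Condition.exists_le_induction`). There are only countably many requirements, so
-- `exists_limit_preserving_induction` meets them all. Finally, `Σ₁` induction over `S ∪ {B}`
-- suffices for `M[B]` to satisfy `RCA₀` (`rca0_ext`), as every set of `M[B]` is `Δ₁` over that
-- family.

deriving instance Countable for NTerm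
deriving instance Countable for Form0

/-! ### Bounded definability as a property of predicates, found by instance search. -/

variable {M : Type*} [CommSemiring M] [LinearOrder M]

/-- The functions of an assignment that are given by a term with number parameters. -/
class inductive TermDef : ((ℕ → M) → M) → Prop
  | var (i : ℕ) : TermDef fun u => u i
  | const (c : M) : TermDef fun _ => c
  | add {s t : (ℕ → M) → M} : TermDef s → TermDef t → TermDef fun u => s u + t u
  | mul {s t : (ℕ → M) → M} : TermDef s → TermDef t → TermDef fun u => s u * t u

/-- The predicates of an assignment that are given by a bounded formula with number parameters and
with set parameters from the family `𝒵`. -/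
class inductive BoundedDef (𝒵 : Set (Set M)) : ((ℕ → M) → Prop) → Prop
  | eq {s t : (ℕ → M) → M} : TermDef s → TermDef t → BoundedDef 𝒵 fun u => s u = t u
  | lt {s t : (ℕ → M) → M} : TermDef s → TermDef t → BoundedDef 𝒵 fun u => s u < t u
  | mem {t : (ℕ → M) → M} {X : Set M} : X ∈ 𝒵 → TermDef t → BoundedDef 𝒵 fun u => t u ∈ X
  | neg {P : (ℕ → M) → Prop} : BoundedDef 𝒵 P → BoundedDef 𝒵 fun u => ¬ P u
  | and {P Q : (ℕ → M) → Prop} :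
      BoundedDef 𝒵 P → BoundedDef 𝒵 Q → BoundedDef 𝒵 fun u => P u ∧ Q u
  | ball {t : (ℕ → M) → M} {P : (ℕ → M) → Prop} : TermDef t → BoundedDef 𝒵 P →
      BoundedDef 𝒵 fun u => ∀ x : M, x < t u → P (push x u)

section TermDef

variable {s t : (ℕ → M) → M}

instance (i : ℕ) : TermDef (M := M) fun u => u i := .var i
instance (c : M) : TermDef fun _ => c := .const c
instance [hs : TermDef s] [ht : TermDef t] : TermDef fun u => s u + t u := .add hs ht
instance [hs : TermDef s] [ht : TermDef t] : TermDef fun u => s u * t u := .mul hs ht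
instance [TermDef s] [TermDef t] : TermDef fun u => pair (s u) (t u) := by
  unfold pair; infer_instance

theorem TermDef.subst (ht : TermDef t) {r : ℕ → (ℕ → M) → M} (hr : ∀ i, TermDef (r i)) :
    TermDef fun u => t fun i => r i u := by
  induction ht with
  | var i => exact hr i
  | const c => exact .const c
  | add _ _ h₁ h₂ => exact .add h₁ h₂
  | mul _ _ h₁ h₂ => exact .mul h₁ h₂

theorem TermDef.push {r : ℕ → (ℕ → M) → M} (ht : TermDef t) (hr : ∀ i, TermDef (r i)) (i : ℕ) :
    TermDef fun u => SecondOrderArith.push (t u) (fun j => r j u) i := by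
  cases i with
  | zero => exact ht
  | succ i => exact hr i

theorem NTerm.termDef_val (τ : NTerm) {r : ℕ → (ℕ → M) → M} (hr : ∀ i, TermDef (r i)) :
    TermDef fun u => τ.val fun i => r i u := by
  induction τ with
  | var i => exact hr i
  | zero => exact .const 0
  | one => exact .const 1
  | add _ _ h₁ h₂ => exact .add h₁ h₂
  | mul _ _ h₁ h₂ => exact .mul h₁ h₂

theorem TermDef.monotone [PMinus M] (ht : TermDef t) : Monotone t := by
  induction ht with
  | var i => exact fun u v h => h i
  | const c => exact fun u v h => le_rfl
  | add _ _ h₁ h₂ => exact fun u v h => add_le_add (h₁ h) (h₂ h)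
  | mul _ _ h₁ h₂ => exact fun u v h => mul_le_mul' (h₁ h) (h₂ h)

end TermDef

namespace BoundedDef

variable {𝒵 : Set (Set M)} {s t : (ℕ → M) → M} {P Q : (ℕ → M) → Prop}

theorem congr (hP : BoundedDef 𝒵 P) (h : ∀ u, Q u ↔ P u) : BoundedDef 𝒵 Q := by
  rwa [show Q = P from funext fun u => propext (h u)]

instance [hs : TermDef s] [ht : TermDef t] : BoundedDef 𝒵 fun u => s u = t u := .eq hs ht
instance [hs : TermDef s] [ht : TermDef t] : BoundedDef 𝒵 fun u => s u < t u := .lt hs ht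
instance {X : Set M} [hX : Fact (X ∈ 𝒵)] [ht : TermDef t] : BoundedDef 𝒵 fun u => t u ∈ X :=
  .mem hX.out ht
instance [hP : BoundedDef 𝒵 P] : BoundedDef 𝒵 fun u => ¬ P u := .neg hP
instance [hP : BoundedDef 𝒵 P] [hQ : BoundedDef 𝒵 Q] : BoundedDef 𝒵 fun u => P u ∧ Q u :=
  .and hP hQ
instance [TermDef s] [TermDef t] : BoundedDef 𝒵 fun u => s u ≤ t u :=
  congr (P := fun u => ¬ t u < s u) inferInstance fun _ => not_lt.symm
instance [BoundedDef 𝒵 P] [BoundedDef 𝒵 Q] : BoundedDef 𝒵 fun u => P u ∨ Q u :=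
  congr (P := fun u => ¬ (¬ P u ∧ ¬ Q u)) inferInstance fun _ => by tauto
instance [BoundedDef 𝒵 P] [BoundedDef 𝒵 Q] : BoundedDef 𝒵 fun u => P u → Q u :=
  congr (P := fun u => ¬ P u ∨ Q u) inferInstance fun _ => by tauto
instance [BoundedDef 𝒵 P] [BoundedDef 𝒵 Q] : BoundedDef 𝒵 fun u => P u ↔ Q u :=
  congr (P := fun u => (P u → Q u) ∧ (Q u → P u)) inferInstance fun _ => by tauto
-- With the bound variable as a separate argument of `R`, unification applies to quantifiers as they
-- are usually written.
instance ballInst {R : M → (ℕ → M) → Prop} [ht : TermDef t]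
    [hR : BoundedDef 𝒵 fun u => R (u 0) fun i => u (i + 1)] :
    BoundedDef 𝒵 fun u => ∀ x, x < t u → R x u := .ball ht hR
instance bexInst {R : M → (ℕ → M) → Prop} [TermDef t]
    [BoundedDef 𝒵 fun u => R (u 0) fun i => u (i + 1)] :
    BoundedDef 𝒵 fun u => ∃ x, x < t u ∧ R x u :=
  congr (P := fun u => ¬ ∀ x, x < t u → ¬ R x u) inferInstance fun _ => by push Not; rfl

theorem subst (hP : BoundedDef 𝒵 P) {r : ℕ → (ℕ → M) → M} (hr : ∀ i, TermDef (r i)) :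
    BoundedDef 𝒵 fun u => P fun i => r i u := by
  induction hP generalizing r with
  | eq h₁ h₂ => exact .eq (h₁.subst hr) (h₂.subst hr)
  | lt h₁ h₂ => exact .lt (h₁.subst hr) (h₂.subst hr)
  | mem hX h => exact .mem hX (h.subst hr)
  | neg _ ih => exact .neg (ih hr)
  | and _ _ ih₁ ih₂ => exact .and (ih₁ hr) (ih₂ hr)
  | @ball t P ht hP ih =>
    have := ih (r := fun i u => push (u 0) (fun j => r j fun i => u (i + 1)) i)
      (TermDef.push (.var 0) fun i => (hr i).subst fun j => .var (j + 1))
    exact ballInst (R := fun x u => P (push x fun j => r j u)) (ht := ht.subst hr) (hR := this)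

/-- The sets may vary with the assignment; forcing needs this for coded sets whose codes are
quantified variables. -/
theorem sat {k : ℕ} (φ : Form0 k) {Z : (ℕ → M) → Fin k → Set M} {r : ℕ → (ℕ → M) → M}
    (hZ : ∀ i, BoundedDef 𝒵 fun u => u 0 ∈ Z (fun j => u (j + 1)) i) (hr : ∀ i, TermDef (r i)) :
    BoundedDef 𝒵 fun u => φ.Sat (Z u) fun i => r i u := by
  induction φ generalizing Z r with
  | eq s t => exact .eq (s.termDef_val hr) (t.termDef_val hr)
  | lt s t => exact .lt (s.termDef_val hr) (t.termDef_val hr)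
  | mem t i =>
    exact (hZ i).subst (r := fun i u => push (t.val fun i => r i u) u i)
      (TermDef.push (t.termDef_val hr) .var)
  | neg _ ih => exact .neg (ih hZ hr)
  | and _ _ ih₁ ih₂ => exact .and (ih₁ hZ hr) (ih₂ hZ hr)
  | ball t φ ih =>
    have := ih (Z := fun u => Z fun j => u (j + 1))
      (r := fun i u => push (u 0) (fun j => r j fun i => u (i + 1)) i)
      (fun i => (hZ i).subst (r := fun i u => push (u 0) (fun j => u (j + 2)) i)
        (TermDef.push (.var 0) fun j => .var (j + 2)))
      (TermDef.push (.var 0) fun i => (hr i).subst fun j => .var (j + 1))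
    exact ballInst (R := fun x u => φ.Sat (Z u) (push x fun j => r j u))
      (ht := t.termDef_val hr) (hR := this)

theorem changeFamily {𝒴 : Set (Set M)} (hP : BoundedDef 𝒴 P)
    (h : ∀ X ∈ 𝒴, BoundedDef 𝒵 fun u => u 0 ∈ X) : BoundedDef 𝒵 P := by
  induction hP with
  | eq h₁ h₂ => exact .eq h₁ h₂
  | lt h₁ h₂ => exact .lt h₁ h₂
  | mem hX ht => exact (h _ hX).subst fun _ => ht
  | neg _ ih => exact .neg ih
  | and _ _ ih₁ ih₂ => exact .and ih₁ ih₂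
  | ball ht _ ih => exact .ball ht ih

end BoundedDef

/-! ### From definable predicates back to formulas. -/

/-- The first `n` entries of `u`, followed by the entries of `c`. -/
def splice (c : ℕ → M) (n : ℕ) (u : ℕ → M) : ℕ → M := fun i => if i < n then u i else c (i - n)

theorem push_splice (c : ℕ → M) (n : ℕ) (u : ℕ → M) (x : M) :
    push x (splice c n u) = splice c (n + 1) (push x u) := by
  funext i
  cases i <;> simp [push, splice]

theorem push_splice_zero (c : ℕ → M) (u : ℕ → M) (x : M) :
    push x c = splice c 1 (push x u) := by
  funext i
  cases i <;> simp [push, splice]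

theorem TermDef.exists_nTerm {c : ℕ → M} (hc : Function.Surjective c) {t : (ℕ → M) → M}
    (ht : TermDef t) (n : ℕ) :
    ∃ τ : NTerm, ∀ u : ℕ → M, (∀ i, n ≤ i → u i = 0) → t u = τ.val (splice c n u) := by
  induction ht with
  | var i =>
    by_cases hi : i < n
    · exact ⟨.var i, fun u _ => by simp [NTerm.val, splice, hi]⟩
    -- Slots from `n` on hold the parameters, so a variable there is replaced by its assumed value
    -- `0`.
    · exact ⟨.zero, fun u hu => by simp [NTerm.val, hu i (not_lt.1 hi)]⟩
  | const a =>
    obtain ⟨i, rfl⟩ := hc a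
    exact ⟨.var (n + i), fun u _ => by simp [NTerm.val, splice]⟩
  | add _ _ h₁ h₂ =>
    obtain ⟨τ₁, h₁⟩ := h₁
    obtain ⟨τ₂, h₂⟩ := h₂
    exact ⟨.add τ₁ τ₂, fun u hu => by simp [NTerm.val, h₁ u hu, h₂ u hu]⟩
  | mul _ _ h₁ h₂ =>
    obtain ⟨τ₁, h₁⟩ := h₁
    obtain ⟨τ₂, h₂⟩ := h₂
    exact ⟨.mul τ₁ τ₂, fun u hu => by simp [NTerm.val, h₁ u hu, h₂ u hu]⟩

/-- A bounded definable predicate is given by an actual formula, in which the parameters come from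
fixed enumerations of `M` and of the family of set parameters. -/
theorem BoundedDef.exists_form {c : ℕ → M} (hc : Function.Surjective c) {𝒵 : Set (Set M)}
    {E : ℕ → Set M} (hE : ∀ X ∈ 𝒵, ∃ i, E i = X) {P : (ℕ → M) → Prop} (hP : BoundedDef 𝒵 P) :
    ∃ k₀, ∀ k, k₀ ≤ k → ∀ n, ∃ φ : Form0 k, ∀ u : ℕ → M, (∀ i, n ≤ i → u i = 0) →
      (P u ↔ φ.Sat (fun i => E i) (splice c n u)) := by
  induction hP with
  | eq h₁ h₂ =>
    refine ⟨0, fun k _ n => ?_⟩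
    obtain ⟨τ₁, h₁⟩ := h₁.exists_nTerm hc n
    obtain ⟨τ₂, h₂⟩ := h₂.exists_nTerm hc n
    exact ⟨.eq τ₁ τ₂, fun u hu => by simp [Form0.Sat, h₁ u hu, h₂ u hu]⟩
  | lt h₁ h₂ =>
    refine ⟨0, fun k _ n => ?_⟩
    obtain ⟨τ₁, h₁⟩ := h₁.exists_nTerm hc n
    obtain ⟨τ₂, h₂⟩ := h₂.exists_nTerm hc n
    exact ⟨.lt τ₁ τ₂, fun u hu => by simp [Form0.Sat, h₁ u hu, h₂ u hu]⟩
  | mem hX ht =>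
    obtain ⟨i, rfl⟩ := hE _ hX
    refine ⟨i + 1, fun k hk n => ?_⟩
    obtain ⟨τ, h⟩ := ht.exists_nTerm hc n
    exact ⟨.mem τ ⟨i, hk⟩, fun u hu => by simp [Form0.Sat, h u hu]⟩
  | neg _ ih =>
    obtain ⟨k₀, ih⟩ := ih
    refine ⟨k₀, fun k hk n => ?_⟩
    obtain ⟨φ, hφ⟩ := ih k hk n
    exact ⟨.neg φ, fun u hu => by simp [Form0.Sat, hφ u hu]⟩
  | and _ _ ih₁ ih₂ =>
    obtain ⟨k₁, ih₁⟩ := ih₁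
    obtain ⟨k₂, ih₂⟩ := ih₂
    -- Both conjuncts need the same number of set variables, hence the claim for all large `k`.
    refine ⟨max k₁ k₂, fun k hk n => ?_⟩
    obtain ⟨φ, hφ⟩ := ih₁ k (le_of_max_le_left hk) n
    obtain ⟨ψ, hψ⟩ := ih₂ k (le_of_max_le_right hk) n
    exact ⟨.and φ ψ, fun u hu => by simp [Form0.Sat, hφ u hu, hψ u hu]⟩
  | ball ht _ ih =>
    obtain ⟨k₀, ih⟩ := ih
    refine ⟨k₀, fun k hk n => ?_⟩
    obtain ⟨τ, h⟩ := ht.exists_nTerm hc n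
    obtain ⟨φ, hφ⟩ := ih k hk (n + 1)
    refine ⟨.ball τ φ, fun u hu => ?_⟩
    simp only [Form0.Sat, h u hu, push_splice]
    refine forall₂_congr fun x _ => hφ _ fun i hi => ?_
    obtain ⟨i, rfl⟩ : ∃ j, i = j + 1 := ⟨i - 1, by omega⟩
    exact hu i (by omega)

section Sigma

variable {c : ℕ → M} (hc : Function.Surjective c) {𝒵 : Set (Set M)} {E : ℕ → Set M}
  (hE : ∀ X ∈ 𝒵, ∃ i, E i = X)

include hc hE

theorem exists_form_two {R : M → M → Prop} (hR : BoundedDef 𝒵 fun u => R (u 0) (u 1)) :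
    ∃ k₀, ∀ k, k₀ ≤ k → ∃ φ : Form0 k, ∀ x y,
      R y x ↔ φ.Sat (fun i => E i) (push y (push x c)) := by
  obtain ⟨k₀, h⟩ := hR.exists_form hc hE
  refine ⟨k₀, fun k hk => ?_⟩
  obtain ⟨φ, hφ⟩ := h k hk 2
  refine ⟨φ, fun x y => ?_⟩
  rw [push_splice_zero c (fun _ => 0) x, push_splice]
  refine hφ (push y (push x fun _ => 0)) fun i hi => ?_
  obtain ⟨i, rfl⟩ : ∃ j, i = j + 2 := ⟨i - 2, by omega⟩
  rfl

theorem exists_form_three {R : M → M → M → Prop}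
    (hR : BoundedDef 𝒵 fun u => R (u 0) (u 1) (u 2)) :
    ∃ k₀, ∀ k, k₀ ≤ k → ∃ φ : Form0 k, ∀ x y z,
      R z y x ↔ φ.Sat (fun i => E i) (push z (push y (push x c))) := by
  obtain ⟨k₀, h⟩ := hR.exists_form hc hE
  refine ⟨k₀, fun k hk => ?_⟩
  obtain ⟨φ, hφ⟩ := h k hk 3
  refine ⟨φ, fun x y z => ?_⟩
  rw [push_splice_zero c (fun _ => 0) x, push_splice, push_splice]
  refine hφ (push z (push y (push x fun _ => 0))) fun i hi => ?_
  obtain ⟨i, rfl⟩ : ∃ j, i = j + 3 := ⟨i - 3, by omega⟩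
  rfl

end Sigma

end

section

/-! ### Arithmetic in `P⁻`: divisibility, pairing, coprime moduli. -/

section Arithmetic

variable {M : Type*} [CommSemiring M] [LinearOrder M] [PMinus M] {x y z d : M}

theorem lt_add_one_iff_le : x < y + 1 ↔ x ≤ y := by
  refine ⟨fun h => not_lt.1 fun hyx => ?_, fun h => h.trans_lt (lt_add_one y)⟩
  obtain ⟨d, rfl⟩ := exists_add_of_le hyx.le
  have hd : 0 < d := pos_of_ne_zero fun h0 => by simp [h0] at hyx
  exact h.not_ge (add_le_add le_rfl (PMinus.one_le_of_pos d hd))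

theorem add_one_le_of_lt (h : x < y) : x + 1 ≤ y :=
  not_lt.1 fun h' => (lt_add_one_iff_le.1 h').not_gt h

theorem exists_eq_add_one (h : 0 < x) : ∃ y, x = y + 1 := by
  obtain ⟨y, rfl⟩ := exists_add_of_le (PMinus.one_le_of_pos x h)
  exact ⟨y, add_comm _ _⟩

theorem lt_add_one_iff_lt_or_eq : x < y + 1 ↔ x < y ∨ x = y := by
  rw [lt_add_one_iff_le, le_iff_lt_or_eq]

theorem le_of_dvd_of_pos (hy : 0 < y) (h : x ∣ y) : x ≤ y := by
  obtain ⟨k, rfl⟩ := h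
  have hk : 0 < k := pos_of_ne_zero fun h0 => by simp [h0] at hy
  exact le_mul_of_one_le_right zero_le (PMinus.one_le_of_pos k hk)

theorem dvd_of_dvd_add_right (h : d ∣ x + y) (hy : d ∣ y) : d ∣ x := by
  obtain ⟨k, hk⟩ := h
  obtain ⟨l, rfl⟩ := hy
  rcases le_total l k with hlk | hlk
  · obtain ⟨r, rfl⟩ := exists_add_of_le hlk
    refine ⟨r, add_right_cancel (b := d * l) ?_⟩
    rw [hk]; ring
  · have h1 : x + d * l ≤ 0 + d * l := by
      rw [hk, zero_add]; exact mul_le_mul' le_rfl hlk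
    have h2 : x = 0 := le_antisymm (le_of_add_le_add_right h1) zero_le
    exact h2 ▸ dvd_zero d

theorem dvd_iff_exists_lt : x ∣ y ↔ ∃ k, k < y + 1 ∧ y = x * k := by
  refine ⟨fun ⟨k, hk⟩ => ?_, fun ⟨k, _, hk⟩ => ⟨k, hk⟩⟩
  rcases eq_or_lt_of_le (zero_le (a := x)) with h0 | h0
  · exact ⟨0, by positivity, by simp [hk, ← h0]⟩
  · refine ⟨k, lt_add_one_iff_le.2 ?_, hk⟩
    rw [hk]
    exact le_mul_of_one_le_left zero_le (PMinus.one_le_of_pos x h0)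

theorem pair_mono {x x' y y' : M} (hx : x ≤ x') (hy : y ≤ y') : pair x y ≤ pair x' y' := by
  unfold pair; gcongr

/-- A pair lies between the square of its sum and the next square, so it determines the sum and then
the first component. -/
theorem sq_add_lt {s t x : M} (h : s < t) (hx : x ≤ s) : s * s + x < t * t := by
  have h1 : (s + 1) * (s + 1) ≤ t * t := mul_le_mul' (add_one_le_of_lt h) (add_one_le_of_lt h)
  refine lt_of_lt_of_le ?_ h1
  calc s * s + x ≤ s * s + s := by gcongr
    _ < s * s + s + 1 := lt_add_one _
    _ ≤ s * s + s + 1 + s := le_self_add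
    _ = (s + 1) * (s + 1) := by ring

theorem pair_inj {x y x' y' : M} : pair x y = pair x' y' ↔ x = x' ∧ y = y' := by
  refine ⟨fun h => ?_, fun ⟨h₁, h₂⟩ => h₁ ▸ h₂ ▸ rfl⟩
  unfold pair at h
  rcases lt_trichotomy (x + y) (x' + y') with h1 | h1 | h1
  · exact absurd h (((sq_add_lt h1 le_self_add).trans_le le_self_add).ne)
  · rw [h1] at h
    obtain rfl := add_left_cancel h
    exact ⟨rfl, add_left_cancel h1⟩
  · exact absurd h (((sq_add_lt h1 le_self_add).trans_le le_self_add).ne')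

theorem le_pair_right (x y : M) : y ≤ pair x y := by
  unfold pair
  rcases eq_or_lt_of_le (zero_le (a := y)) with h | h
  · rw [← h]; exact zero_le
  · calc y ≤ x + y := le_add_self
      _ ≤ (x + y) * (x + y) :=
        le_mul_of_one_le_left zero_le (PMinus.one_le_of_pos _ (h.trans_le le_add_self))
      _ ≤ _ := le_self_add

theorem le_pair_left (x y : M) : x ≤ pair x y := le_add_self

/-- The moduli `1 + (x + 1) b`, for `x < n`, are pairwise coprime if `b` is divisible by
`1, …, n`. -/
theorem modulus_dvd_of_dvd_mul {n b a : M} (hb : ∀ d, d < n → d + 1 ∣ b) {m : M} (hx : x < n)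
    (hm : m < n) (hxm : x ≠ m) (h : 1 + (x + 1) * b ∣ a * (1 + (m + 1) * b)) :
    1 + (x + 1) * b ∣ a := by
  -- Here `d + 1` is the distance of `x` and `m`. Eliminating `b` between the two moduli leaves this
  -- distance; it divides `b`, which is invertible modulo `1 + (x + 1) b`.
  obtain ⟨d, hdn, hd⟩ : ∃ d, d < n ∧ 1 + (x + 1) * b ∣ a * (d + 1) := by
    rcases lt_or_gt_of_ne hxm with hlt | hlt
    · obtain ⟨d, rfl⟩ := exists_add_of_le (add_one_le_of_lt hlt)
      refine ⟨d, (le_add_self).trans_lt hm, ?_⟩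
      have h1 : 1 + (x + 1) * b ∣ a * (d + 1) + a * (1 + (x + 1 + d + 1) * b) * (x + 1) :=
        ⟨a * (x + 1 + d + 1), by ring⟩
      exact dvd_of_dvd_add_right h1 (h.mul_right _)
    · obtain ⟨d, rfl⟩ := exists_add_of_le (add_one_le_of_lt hlt)
      refine ⟨d, (le_add_self).trans_lt hx, ?_⟩
      have h1 : 1 + (m + 1 + d + 1) * b ∣
          a * (d + 1) + (1 + (m + 1 + d + 1) * b) * (a * (m + 1)) := by
        have := h.mul_right (m + 1 + d + 1)
        ring_nf at this ⊢
        exact this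
      exact dvd_of_dvd_add_right h1 (dvd_mul_right _ _)
  obtain ⟨k, hk⟩ := hb d hdn
  have h1 : 1 + (x + 1) * b ∣ a + a * (d + 1) * (k * (x + 1)) := ⟨a, by rw [hk]; ring⟩
  exact dvd_of_dvd_add_right h1 (hd.mul_right _)

end Arithmetic

/-! ### `Σ₁` predicates and their closure properties. -/

variable {M : Type*} [CommSemiring M] [LinearOrder M]

theorem BoundedDef.substPush {𝒵 : Set (Set M)} {Q : M → (ℕ → M) → Prop}
    (hQ : BoundedDef 𝒵 fun u => Q (u 0) fun i => u (i + 1)) {t : (ℕ → M) → M} (ht : TermDef t)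
    {r : ℕ → (ℕ → M) → M} (hr : ∀ i, TermDef (r i)) :
    BoundedDef 𝒵 fun u => Q (t u) fun i => r i u :=
  hQ.subst (r := fun i u => push (t u) (fun j => r j u) i) (TermDef.push ht hr)

/-- The predicates of an assignment that are given by a `Σ₁` formula with number parameters and
with set parameters from the family `𝒵`. -/
def SigmaOneDef (𝒵 : Set (Set M)) (P : (ℕ → M) → Prop) : Prop :=
  ∃ Q : M → (ℕ → M) → Prop, (BoundedDef 𝒵 fun u => Q (u 0) fun i => u (i + 1)) ∧
    ∀ u, P u ↔ ∃ y, Q y u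

/-- Induction for `Σ₁` properties with number parameters and set parameters from `𝒵`. -/
def SigmaOneInduction (𝒵 : Set (Set M)) : Prop :=
  ∀ P : M → Prop, SigmaOneDef 𝒵 (fun u => P (u 0)) → P 0 → (∀ x, P x → P (x + 1)) → ∀ x, P x

namespace SigmaOneDef

variable {𝒵 : Set (Set M)} {P Q : (ℕ → M) → Prop}

theorem congr (hP : SigmaOneDef 𝒵 P) (h : ∀ u, Q u ↔ P u) : SigmaOneDef 𝒵 Q := by
  rwa [show Q = P from funext fun u => propext (h u)]

theorem of_bounded (hP : BoundedDef 𝒵 P) : SigmaOneDef 𝒵 P :=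
  ⟨fun _ u => P u, hP.subst fun i => .var (i + 1), fun _ => by simp⟩

theorem subst (hP : SigmaOneDef 𝒵 P) {r : ℕ → (ℕ → M) → M} (hr : ∀ i, TermDef (r i)) :
    SigmaOneDef 𝒵 fun u => P fun i => r i u := by
  obtain ⟨R, hR, h⟩ := hP
  exact ⟨fun y u => R y fun i => r i u,
    hR.substPush (.var 0) fun i => (hr i).subst fun j => .var (j + 1), fun u => h _⟩

theorem or (hP : SigmaOneDef 𝒵 P) (hQ : SigmaOneDef 𝒵 Q) :
    SigmaOneDef 𝒵 fun u => P u ∨ Q u := by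
  obtain ⟨R₁, hR₁, h₁⟩ := hP
  obtain ⟨R₂, hR₂, h₂⟩ := hQ
  exact ⟨fun y u => R₁ y u ∨ R₂ y u, inferInstance, fun u => by simp only [h₁, h₂, exists_or]⟩

variable [PMinus M]

theorem and (hP : SigmaOneDef 𝒵 P) (hQ : SigmaOneDef 𝒵 Q) :
    SigmaOneDef 𝒵 fun u => P u ∧ Q u := by
  obtain ⟨R₁, hR₁, h₁⟩ := hP
  obtain ⟨R₂, hR₂, h₂⟩ := hQ
  have hR₁ := hR₁.substPush (.var 0) fun i => .var (i + 2)
  have hR₂ := hR₂.substPush (.var 0) fun i => .var (i + 2)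
  refine ⟨fun w u => (∃ y, y < w ∧ R₁ y u) ∧ ∃ y, y < w ∧ R₂ y u, inferInstance, fun u => ?_⟩
  simp only [h₁, h₂]
  constructor
  · rintro ⟨⟨y, hy⟩, z, hz⟩
    exact ⟨max y z + 1, ⟨y, lt_add_one_iff_le.2 (le_max_left _ _), hy⟩, z,
      lt_add_one_iff_le.2 (le_max_right _ _), hz⟩
  · rintro ⟨w, ⟨y, -, hy⟩, z, -, hz⟩
    exact ⟨⟨y, hy⟩, z, hz⟩

/-- Two unbounded quantifiers contract to one strict upper bound for both witnesses. -/
theorem ex {R : M → (ℕ → M) → Prop}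
    (hR : SigmaOneDef 𝒵 fun u => R (u 0) fun i => u (i + 1)) :
    SigmaOneDef 𝒵 fun u => ∃ x, R x u := by
  obtain ⟨Q, hQ, h⟩ := hR
  have h' : ∀ x u, R x u ↔ ∃ y, Q y (push x u) := fun x u => h (push x u)
  have hQ := hQ.substPush (t := fun u => u 0) (.var 0)
    (r := fun i u => push (u 1) (fun j => u (j + 3)) i)
    (TermDef.push (.var 1) fun j => .var (j + 3))
  refine ⟨fun w u => ∃ x, x < w ∧ ∃ y, y < w ∧ Q y (push x u), ?_, fun u => ?_⟩
  · exact BoundedDef.bexInst (R := fun x u => ∃ y, y < u 0 ∧ Q y (push x fun i => u (i + 1)))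
  · constructor
    · rintro ⟨x, hx⟩
      obtain ⟨y, hy⟩ := (h' x u).1 hx
      exact ⟨max x y + 1, x, lt_add_one_iff_le.2 (le_max_left _ _), y,
        lt_add_one_iff_le.2 (le_max_right _ _), hy⟩
    · rintro ⟨w, x, -, y, -, hy⟩
      exact ⟨x, (h' x u).2 ⟨y, hy⟩⟩

/-- `Σ₁` predicates are closed under bounded quantification: `Σ₁` induction implies `Σ₁`
collection. -/
theorem ball (h𝒵 : SigmaOneInduction 𝒵) {t : (ℕ → M) → M} (ht : TermDef t)
    (hP : SigmaOneDef 𝒵 P) : SigmaOneDef 𝒵 fun u => ∀ x, x < t u → P (push x u) := by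
  obtain ⟨Q, hQ, h⟩ := hP
  have hQ₁ := hQ.substPush (t := fun u => u 0) (.var 0)
    (r := fun i u => push (u 1) (fun j => u (j + 3)) i)
    (TermDef.push (.var 1) fun j => .var (j + 3))
  have ht₁ : TermDef fun u => t fun i => u (i + 1) := ht.subst fun i => .var (i + 1)
  refine ⟨fun w u => ∀ x, x < t u → ∃ y, y < w ∧ Q y (push x u), ?_, fun u => ?_⟩
  · exact BoundedDef.ballInst (R := fun x u => ∃ y, y < u 0 ∧ Q y (push x fun i => u (i + 1)))
  · simp only [h]
    refine ⟨fun hx => ?_, fun ⟨w, hw⟩ x hx => (hw x hx).imp fun y hy => hy.2⟩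
    have hQ₂ := hQ.substPush (t := fun v => v 0) (.var 0)
      (r := fun i v => push (v 1) u i)
        (TermDef.push (.var 1) (r := fun i _ => u i) fun j => .const (u j))
    -- Induction on `c` for a common bound of the witnesses below `c`; the guard `x < t u` makes
    -- steps beyond `t u` trivial.
    have hI := h𝒵 (fun c => ∃ w, ∀ x, x < c → x < t u → ∃ y, y < w ∧ Q y (push x u)) ?_ ?_ ?_ (t u)
    · exact hI.imp fun w hw x hx => hw x hx hx
    · refine ⟨fun w v => ∀ x, x < v 0 → x < t u → ∃ y, y < w ∧ Q y (push x u), ?_,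
        fun v => Iff.rfl⟩
      exact BoundedDef.ballInst (t := fun v => v 1)
        (R := fun x v => x < t u → ∃ y, y < v 0 ∧ Q y (push x u))
    · exact ⟨0, fun x hx => absurd hx zero_le.not_gt⟩
    · rintro c ⟨w, hw⟩
      by_cases hc : c < t u
      · obtain ⟨y, hy⟩ := hx c hc
        refine ⟨max w (y + 1), fun x hxc hxt => ?_⟩
        rcases lt_add_one_iff_lt_or_eq.1 hxc with h1 | rfl
        · obtain ⟨z, hz, hz'⟩ := hw x h1 hxt
          exact ⟨z, lt_max_of_lt_left hz, hz'⟩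
        · exact ⟨y, lt_max_of_lt_right (lt_add_one y), hy⟩
      · refine ⟨w, fun x hxc hxt => hw x ?_ hxt⟩
        exact hxt.trans_le (not_lt.1 hc)

end SigmaOneDef

/-- A predicate that is bounded definable from sets that are `Δ₁` over `𝒵` is `Δ₁` over `𝒵`. -/
theorem BoundedDef.deltaOne [PMinus M] {𝒴 𝒵 : Set (Set M)} (h𝒵 : SigmaOneInduction 𝒵)
    (h : ∀ X ∈ 𝒴, SigmaOneDef 𝒵 (fun u => u 0 ∈ X) ∧ SigmaOneDef 𝒵 (fun u => ¬ u 0 ∈ X))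
    {P : (ℕ → M) → Prop} (hP : BoundedDef 𝒴 P) :
    SigmaOneDef 𝒵 P ∧ SigmaOneDef 𝒵 (fun u => ¬ P u) := by
  induction hP with
  | eq h₁ h₂ => exact ⟨.of_bounded (.eq h₁ h₂), .of_bounded (.neg (.eq h₁ h₂))⟩
  | lt h₁ h₂ => exact ⟨.of_bounded (.lt h₁ h₂), .of_bounded (.neg (.lt h₁ h₂))⟩
  | mem hX ht => exact ⟨(h _ hX).1.subst fun _ => ht, (h _ hX).2.subst fun _ => ht⟩
  | neg _ ih => exact ⟨ih.2, by simpa only [not_not] using ih.1⟩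
  | and _ _ ih₁ ih₂ => exact ⟨ih₁.1.and ih₂.1, (ih₁.2.or ih₂.2).congr fun u => by tauto⟩
  | @ball t P ht _ ih =>
    refine ⟨ih.1.ball h𝒵 ht, SigmaOneDef.congr (P := fun u => ∃ x, x < t u ∧ ¬ P (push x u))
      (SigmaOneDef.ex (R := fun x u => x < t u ∧ ¬ P (push x u)) (.and (.of_bounded (.lt (.var 0)
        (ht.subst fun i => .var (i + 1)))) ?_)) fun u => by push Not; rfl⟩
    exact ih.2.subst (r := fun i u => push (u 0) (fun j => u (j + 1)) i)
      (TermDef.push (.var 0) fun j => .var (j + 1))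

/-! ### Gödel coding of bounded sets. -/

section Coding

variable [PMinus M] {𝒵 : Set (Set M)}

instance {s t : (ℕ → M) → M} [TermDef s] [TermDef t] : BoundedDef 𝒵 fun u => s u ∣ t u := by
  have hs : TermDef fun u => s fun i => u (i + 1) :=
    TermDef.subst (t := s) inferInstance fun i => .var (i + 1)
  have ht : TermDef fun u => t fun i => u (i + 1) :=
    TermDef.subst (t := t) inferInstance fun i => .var (i + 1)
  exact BoundedDef.congr (P := fun u => ∃ k, k < t u + 1 ∧ t u = s u * k) inferInstance
    fun u => dvd_iff_exists_lt

instance {t a b n : (ℕ → M) → M} [TermDef t] [TermDef a] [TermDef b] [TermDef n] :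
    BoundedDef 𝒵 fun u => t u ∈ codedSet (a u) (b u) (n u) :=
  inferInstanceAs (BoundedDef 𝒵 fun u => t u < n u ∧ 1 + (t u + 1) * b u ∣ a u)

theorem SigmaOneInduction.bounded (h𝒵 : SigmaOneInduction 𝒵) {R : M → M → Prop}
    (hR : BoundedDef 𝒵 fun u => R (u 0) (u 1)) (h0 : ∃ y, R y 0)
    (hs : ∀ x, (∃ y, R y x) → ∃ y, R y (x + 1)) (x : M) : ∃ y, R y x :=
  h𝒵 (fun x => ∃ y, R y x) ⟨fun y u => R y (u 0), hR, fun _ => Iff.rfl⟩ h0 hs x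

theorem SigmaOneInduction.least (h𝒵 : SigmaOneInduction 𝒵) {R : M → Prop}
    (hR : BoundedDef 𝒵 fun u => R (u 0)) {x : M} (hx : R x) :
    ∃ y, R y ∧ ∀ z, z < y → ¬ R z := by
  by_contra! h
  have hR₁ : BoundedDef 𝒵 fun u => R (u 0) := hR
  have hs : ∀ y, (∀ z, z < y → ¬ R z) → ∀ z, z < y + 1 → ¬ R z := by
    intro y hy z hz
    rcases lt_add_one_iff_lt_or_eq.1 hz with h1 | rfl
    · exact hy z h1
    · intro hz
      obtain ⟨w, hw, hw'⟩ := h z hz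
      exact hy w hw hw'
  obtain ⟨_, h2⟩ := h𝒵.bounded (R := fun _ x => ∀ z, z < x → ¬ R z) (by infer_instance)
    ⟨0, fun z hz => absurd hz zero_le.not_gt⟩ (fun y ⟨_, hy⟩ => ⟨0, hs y hy⟩) (x + 1)
  exact h2 x (lt_add_one x) hx

theorem exists_common_multiple (h𝒵 : SigmaOneInduction 𝒵) (n : M) :
    ∃ b : M, 0 < b ∧ ∀ d, d < n → d + 1 ∣ b := by
  refine h𝒵.bounded (R := fun b n => 0 < b ∧ ∀ d, d < n → d + 1 ∣ b) (by infer_instance)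
    ⟨1, one_pos, fun d hd => absurd hd zero_le.not_gt⟩ ?_ n
  rintro n ⟨b, hb, h⟩
  refine ⟨b * (n + 1), by positivity, fun d hd => ?_⟩
  rcases lt_add_one_iff_lt_or_eq.1 hd with h1 | rfl
  · exact (h d h1).mul_right _
  · exact dvd_mul_left _ _

/-- With `b` fixed, induction on `m` multiplies together the moduli of the elements of `X` below
`m`; pairwise coprimality keeps other moduli from dividing the product. -/
theorem exists_codedSet_eq (h𝒵 : SigmaOneInduction 𝒵) {X : Set M}
    (hX : BoundedDef 𝒵 fun u => u 0 ∈ X) (n : M) :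
    ∃ a b : M, ∀ x, x ∈ codedSet a b n ↔ x < n ∧ x ∈ X := by
  obtain ⟨b, hb0, hb⟩ := exists_common_multiple h𝒵 n
  have hI := h𝒵.bounded
    (R := fun a m => ∀ x, x < n → (1 + (x + 1) * b ∣ a ↔ x < m ∧ x ∈ X)) ?_ ?_ ?_ n
  · obtain ⟨a, ha⟩ := hI
    refine ⟨a, b, fun x => and_congr_right fun hx => (ha x hx).trans (and_iff_right hx)⟩
  · have hX₁ : BoundedDef 𝒵 fun u => u 0 ∈ X := hX
    infer_instance
  · refine ⟨1, fun x _ => ⟨fun h => ?_, fun h => absurd h.1 zero_le.not_gt⟩⟩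
    have h1 : 1 + (x + 1) * b ≤ 1 := le_of_dvd_of_pos one_pos h
    exact absurd h1 (lt_add_of_pos_right _ (by positivity)).not_ge
  · rintro m ⟨a, ha⟩
    by_cases hm : m < n ∧ m ∈ X
    · refine ⟨a * (1 + (m + 1) * b), fun x hx => ?_⟩
      rw [lt_add_one_iff_lt_or_eq]
      by_cases hxm : x = m
      · subst hxm
        exact ⟨fun _ => ⟨.inr rfl, hm.2⟩, fun _ => dvd_mul_left _ _⟩
      · rw [or_iff_left hxm, ← ha x hx]
        exact ⟨modulus_dvd_of_dvd_mul hb hx hm.1 hxm, fun h => h.mul_right _⟩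
    · refine ⟨a, fun x hx => ?_⟩
      rw [ha x hx, lt_add_one_iff_lt_or_eq]
      constructor
      · exact fun h => ⟨.inl h.1, h.2⟩
      · rintro ⟨h1 | rfl, h2⟩
        · exact ⟨h1, h2⟩
        · exact absurd ⟨hx, h2⟩ hm

end Coding

end

/-! ### `RCA₀` in terms of definable predicates, and the extension `M[B]`. -/

section

variable {M : Type*} [CommSemiring M] [LinearOrder M]

theorem IsSigma.sigmaOneDef {k : ℕ} {Z : Fin k → Set M} {X : Set M} (hX : IsSigma 1 Z X)
    {𝒵 : Set (Set M)} (hZ : ∀ i, BoundedDef 𝒵 fun u => u 0 ∈ Z i) :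
    SigmaOneDef 𝒵 fun u => u 0 ∈ X := by
  obtain ⟨φ, v, h⟩ := hX
  refine ⟨fun y u => ¬ φ.Sat Z (push y (push (u 0) v)), .neg ?_, fun u => h _⟩
  exact BoundedDef.sat φ (Z := fun _ => Z) (r := fun i u => push (u 0) (push (u 1) v) i) hZ
    (TermDef.push (.var 0) (TermDef.push (r := fun i _ => v i) (.var 1) fun i => .const (v i)))

section Forms

variable {c : ℕ → M} (hc : Function.Surjective c) {𝒵 : Set (Set M)} {E : ℕ → Set M}
  (hE : ∀ X ∈ 𝒵, ∃ i, E i = X) {X : Set M}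
include hc hE

theorem SigmaOneDef.exists_form {P : M → Prop} (hP : SigmaOneDef 𝒵 fun u => P (u 0)) :
    ∃ k₀, ∀ k, k₀ ≤ k → ∃ φ : Form0 k, ∀ x,
      P x ↔ ∃ y, φ.Sat (fun i => E i) (push y (push x c)) := by
  obtain ⟨Q, hQ, h⟩ := hP
  have hQ : BoundedDef 𝒵 fun u => Q (u 0) fun _ => u 1 := hQ.substPush (.var 0) fun _ => .var 1
  obtain ⟨k₀, hk₀⟩ := exists_form_two (R := fun y x => Q y fun _ => x) hc hE hQ
  refine ⟨k₀, fun k hk => ?_⟩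
  obtain ⟨φ, hφ⟩ := hk₀ k hk
  exact ⟨φ, fun x => (h fun _ => x).trans (exists_congr fun y => hφ x y)⟩

theorem SigmaOneDef.isSigma (hX : SigmaOneDef 𝒵 fun u => u 0 ∈ X) :
    ∃ k₀, ∀ k, k₀ ≤ k → IsSigma 1 (fun i : Fin k => E i) X := by
  obtain ⟨k₀, hk₀⟩ := hX.exists_form hc hE
  refine ⟨k₀, fun k hk => ?_⟩
  obtain ⟨φ, hφ⟩ := hk₀ k hk
  -- `SigmaSat` at level one negates its matrix.
  exact ⟨.neg φ, c, fun x => (hφ x).trans (by simp [SigmaSat, Form0.Sat])⟩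

theorem isDelta_of_sigmaOneDef (h₁ : SigmaOneDef 𝒵 fun u => u 0 ∈ X)
    (h₂ : SigmaOneDef 𝒵 fun u => ¬ u 0 ∈ X) : ∃ k, IsDelta 1 (fun i : Fin k => E i) X := by
  obtain ⟨k₁, hk₁⟩ := h₁.isSigma hc hE
  obtain ⟨k₂, hk₂⟩ := SigmaOneDef.isSigma (X := Xᶜ) hc hE h₂
  exact ⟨max k₁ k₂, hk₁ _ (le_max_left _ _), hk₂ _ (le_max_right _ _)⟩

end Forms

/-- Replace every set variable by the only set variable of a formula with one set variable. -/
def Form0.collapse {k : ℕ} : Form0 k → Form0 1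
  | .eq s t => .eq s t
  | .lt s t => .lt s t
  | .mem t _ => .mem t 0
  | .neg φ => .neg φ.collapse
  | .and φ ψ => .and φ.collapse ψ.collapse
  | .ball t φ => .ball t φ.collapse

theorem Form0.sat_collapse {k : ℕ} (φ : Form0 k) (A : Set M) (v : ℕ → M) :
    φ.collapse.Sat (fun _ => A) v ↔ φ.Sat (fun _ => A) v := by
  induction φ generalizing v <;> simp_all [Form0.collapse, Form0.Sat]

theorem IsSigma.collapse {k n : ℕ} {A X : Set M} (h : IsSigma n (fun _ : Fin k => A) X) :
    IsSigma n (fun _ : Fin 1 => A) X := by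
  obtain ⟨φ, v, h⟩ := h
  have key : ∀ n v, SigmaSat (fun _ : Fin 1 => A) φ.collapse n v ↔
      SigmaSat (fun _ : Fin k => A) φ n v := by
    intro n
    induction n with
    | zero => exact φ.sat_collapse A
    | succ n ih => simp [SigmaSat, ih]
  exact ⟨φ.collapse, v, fun x => (h x).trans (key _ _).symm⟩

section Countable

variable [Countable M]

theorem isDeltaIn_one_of_sigmaOneDef {A X : Set M} (h₁ : SigmaOneDef {A} fun u => u 0 ∈ X)
    (h₂ : SigmaOneDef {A} fun u => ¬ u 0 ∈ X) : IsDeltaIn 1 A X := by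
  obtain ⟨c, hc⟩ := exists_surjective_nat M
  obtain ⟨k, hk⟩ := isDelta_of_sigmaOneDef (E := fun _ => A) hc (by simp) h₁ h₂
  exact ⟨hk.1.collapse, hk.2.collapse⟩

theorem isSigma_two_of_boundedDef {A X : Set M} {R : M → M → M → Prop}
    (hR : BoundedDef {A} fun u => R (u 0) (u 1) (u 2))
    (h : ∀ x, x ∈ X ↔ ∃ y, ∀ z, R z y x) : IsSigma 2 (fun _ : Fin 1 => A) X := by
  obtain ⟨c, hc⟩ := exists_surjective_nat M
  obtain ⟨k, hk⟩ := exists_form_three (E := fun _ => A) hc (by simp) hR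
  obtain ⟨φ, hφ⟩ := hk k le_rfl
  refine IsSigma.collapse (k := k) ⟨φ, c, fun x => ?_⟩
  simp [SigmaSat, h, hφ]

variable [PMinus M] {S : Set (Set M)}

theorem RCA0.nonempty (hM : RCA0 S) : S.Nonempty :=
  ⟨Set.univ, hM.comprehension 0 Fin.elim0 (fun i => i.elim0) _
    ⟨⟨.neg (.eq .zero .zero), fun _ => 0, by simp [SigmaSat, Form0.Sat]⟩,
      ⟨.eq .zero .zero, fun _ => 0, by simp [SigmaSat, Form0.Sat]⟩⟩⟩

/-- By countability, fixed enumerations supply the number and set parameters of any formula. -/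
theorem RCA0.sigmaOneInduction (hM : RCA0 S) (hS : S.Countable) : SigmaOneInduction S := by
  intro P hP h0 hs
  obtain ⟨c, hc⟩ := exists_surjective_nat M
  obtain ⟨E, rfl⟩ := hS.exists_eq_range hM.nonempty
  obtain ⟨k, hk⟩ := SigmaOneDef.isSigma (X := {x | P x}) hc (E := E) (fun X hX => hX) hP
  exact hM.induction k _ (fun i => ⟨i, rfl⟩) _ (hk k le_rfl) h0 hs

theorem RCA0.mem_of_sigmaOneDef (hM : RCA0 S) (hS : S.Countable) {X : Set M}
    (h₁ : SigmaOneDef S fun u => u 0 ∈ X) (h₂ : SigmaOneDef S fun u => ¬ u 0 ∈ X) : X ∈ S := by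
  obtain ⟨c, hc⟩ := exists_surjective_nat M
  obtain ⟨E, rfl⟩ := hS.exists_eq_range hM.nonempty
  obtain ⟨k, hk⟩ := isDelta_of_sigmaOneDef hc (E := E) (fun X hX => hX) h₁ h₂
  exact hM.comprehension k _ (fun i => ⟨i, rfl⟩) _ hk

theorem RCA0.mem_of_boundedDef (hM : RCA0 S) (hS : S.Countable) {X : Set M}
    (h : BoundedDef S fun u => u 0 ∈ X) : X ∈ S :=
  hM.mem_of_sigmaOneDef hS (.of_bounded h) (.of_bounded h.neg)

theorem boundedDef_join (A B : Set M) : BoundedDef {A, B} fun u => u 0 ∈ join A B := by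
  have hA : Fact (A ∈ ({A, B} : Set (Set M))) := ⟨by simp⟩
  have hB : Fact (B ∈ ({A, B} : Set (Set M))) := ⟨by simp⟩
  refine BoundedDef.congr (P := fun u => (∃ a, a < u 0 + 1 ∧ a ∈ A ∧ u 0 = 2 * a) ∨
    ∃ b, b < u 0 + 1 ∧ b ∈ B ∧ u 0 = 2 * b + 1) inferInstance fun u => ?_
  have h2 : ∀ a : M, a ≤ 2 * a := fun a => le_mul_of_one_le_left zero_le one_le_two
  constructor
  · rintro (⟨a, ha, h⟩ | ⟨b, hb, h⟩)
    · exact .inl ⟨a, lt_add_one_iff_le.2 (h ▸ h2 a), ha, h⟩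
    · exact .inr ⟨b, lt_add_one_iff_le.2 (h ▸ (h2 b).trans le_self_add), hb, h⟩
  · rintro (⟨a, -, ha, h⟩ | ⟨b, -, hb, h⟩)
    · exact .inl ⟨a, ha, h⟩
    · exact .inr ⟨b, hb, h⟩

theorem two_mul_ne_two_mul_add_one (a b : M) : 2 * a ≠ 2 * b + 1 := by
  intro h
  rcases le_or_gt a b with h1 | h1
  · exact absurd h (((mul_le_mul' le_rfl h1).trans_lt (lt_add_one _)).ne)
  · have h2 : 2 * (b + 1) ≤ 2 * a := mul_le_mul' le_rfl (add_one_le_of_lt h1)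
    rw [h, mul_add, mul_one, ← one_add_one_eq_two, ← add_assoc] at h2
    exact absurd h2 (lt_add_one _).not_ge

theorem two_mul_mem_join {A B : Set M} {x : M} : 2 * x ∈ join A B ↔ x ∈ A := by
  refine ⟨?_, fun h => .inl ⟨x, h, rfl⟩⟩
  rintro (⟨a, ha, h⟩ | ⟨b, -, h⟩)
  · exact mul_left_cancel₀ two_ne_zero h ▸ ha
  · exact absurd h (two_mul_ne_two_mul_add_one _ _)

theorem two_mul_add_one_mem_join {A B : Set M} {x : M} : 2 * x + 1 ∈ join A B ↔ x ∈ B := by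
  refine ⟨?_, fun h => .inr ⟨x, h, rfl⟩⟩
  rintro (⟨a, -, h⟩ | ⟨b, hb, h⟩)
  · exact absurd h.symm (two_mul_ne_two_mul_add_one _ _)
  · exact mul_left_cancel₀ two_ne_zero (add_right_cancel h) ▸ hb

variable {B : Set M}

/-- Join and `Δ₁` comprehension do not leave the sets that are `Δ₁` over `S ∪ {B}`, because `Σ₁`
collection is available there. -/
theorem Ext.deltaOne (hI : SigmaOneInduction (insert B S)) {A : Set M} (hA : Ext S B A) :
    SigmaOneDef (insert B S) (fun u => u 0 ∈ A) ∧
      SigmaOneDef (insert B S) (fun u => ¬ u 0 ∈ A) := by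
  have base : ∀ A ∈ insert B S, SigmaOneDef (insert B S) (fun u => u 0 ∈ A) ∧
      SigmaOneDef (insert B S) (fun u => ¬ u 0 ∈ A) := fun A hA =>
    ⟨.of_bounded (.mem hA (.var 0)), .of_bounded (.neg (.mem hA (.var 0)))⟩
  induction hA with
  | base A hA => exact base A (.inr hA)
  | gen => exact base B (.inl rfl)
  | join A A' _ _ ih ih' =>
    refine (boundedDef_join A A').deltaOne hI ?_
    rintro X (rfl | rfl)
    exacts [ih, ih']
  | delta A X _ hX ih =>
    have key : ∀ Y, IsSigma 1 (fun _ : Fin 1 => A) Y →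
        SigmaOneDef (insert B S) fun u => u 0 ∈ Y := by
      intro Y hY
      obtain ⟨Q, hQ, h⟩ := hY.sigmaOneDef (𝒵 := {A}) fun _ => .mem rfl (.var 0)
      have := (hQ.deltaOne hI (by rintro X rfl; exact ih)).1
      exact (SigmaOneDef.ex this).congr h
    exact ⟨key _ hX.1, key _ hX.2⟩

/-- Iterated joins merge finitely many parameters into one, as the `delta` clause of `Ext` demands.
-/
theorem Ext.exists_common (hS : ∃ A, Ext S B A) {k : ℕ} (Z : Fin k → Set M)
    (hZ : ∀ i, Ext S B (Z i)) :
    ∃ A, Ext S B A ∧ ∀ i, BoundedDef {A} fun u => u 0 ∈ Z i := by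
  induction k with
  | zero => exact hS.imp fun A hA => ⟨hA, fun i => i.elim0⟩
  | succ k ih =>
    obtain ⟨A, hA, h⟩ := ih (fun i => Z i.succ) fun i => hZ _
    have hJ : Fact (SecondOrderArith.join (Z 0) A ∈ ({SecondOrderArith.join (Z 0) A} :
        Set (Set M))) := ⟨rfl⟩
    refine ⟨_, .join _ _ (hZ 0) hA, Fin.cases ?_ fun i => (h i).changeFamily ?_⟩
    · exact BoundedDef.congr (P := fun u => 2 * u 0 ∈ SecondOrderArith.join (Z 0) A) inferInstance
        fun u => two_mul_mem_join.symm
    · intro Y hY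
      rw [Set.mem_singleton_iff.1 hY]
      exact BoundedDef.congr (P := fun u => 2 * u 0 + 1 ∈ SecondOrderArith.join (Z 0) A)
        inferInstance fun u => two_mul_add_one_mem_join.symm

theorem rca0_ext (hI : SigmaOneInduction (insert B S)) : RCA0 (ext S B) where
  induction k Z hZ X hX := by
    refine hI (fun x => x ∈ X) ?_
    obtain ⟨Q, hQ, h⟩ := hX.sigmaOneDef (𝒵 := Set.range Z) fun i => .mem ⟨i, rfl⟩ (.var 0)
    have := (hQ.deltaOne hI (by rintro _ ⟨i, rfl⟩; exact (hZ i).deltaOne hI)).1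
    exact (SigmaOneDef.ex this).congr h
  comprehension k Z hZ X hX := by
    obtain ⟨A, hA, h⟩ := Ext.exists_common ⟨B, .gen⟩ Z hZ
    exact .delta A X hA (isDeltaIn_one_of_sigmaOneDef (hX.1.sigmaOneDef h) (hX.2.sigmaOneDef h))

end Countable

end

/-! ### Forcing a limit while preserving `Σ₁` induction. -/

section

variable {M : Type*} [CommSemiring M] [LinearOrder M] [PMinus M]

/-- The truth of a bounded formula depends only on the part of the set variables below a bound that
is given by a term. -/
theorem Form0.exists_use {k : ℕ} (φ : Form0 k) :
    ∃ b : (ℕ → M) → M, TermDef b ∧ ∀ (v : ℕ → M) (Z Z' : Fin k → Set M),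
      (∀ i z, z < b v → (z ∈ Z i ↔ z ∈ Z' i)) → (φ.Sat Z v ↔ φ.Sat Z' v) := by
  induction φ with
  | eq s t => exact ⟨fun _ => 0, .const 0, fun _ _ _ _ => Iff.rfl⟩
  | lt s t => exact ⟨fun _ => 0, .const 0, fun _ _ _ _ => Iff.rfl⟩
  | mem t i =>
    exact ⟨fun u => t.val u + 1, .add (t.termDef_val .var) (.const 1),
      fun v Z Z' h => h i _ (lt_add_one _)⟩
  | neg φ ih =>
    obtain ⟨b, hb, h⟩ := ih
    exact ⟨b, hb, fun v Z Z' hZ => not_congr (h v Z Z' hZ)⟩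
  | and φ ψ ih₁ ih₂ =>
    obtain ⟨b₁, hb₁, h₁⟩ := ih₁
    obtain ⟨b₂, hb₂, h₂⟩ := ih₂
    exact ⟨fun u => b₁ u + b₂ u, .add hb₁ hb₂, fun v Z Z' hZ => and_congr
      (h₁ v Z Z' fun i z hz => hZ i z (hz.trans_le le_self_add))
      (h₂ v Z Z' fun i z hz => hZ i z (hz.trans_le le_add_self))⟩
  | ball t φ ih =>
    obtain ⟨b, hb, h⟩ := ih
    -- Terms are monotone, so the use at the bound `t` covers every `x < t`.
    refine ⟨fun u => b (push (t.val u) u), hb.subst (r := fun i u => push (t.val u) u i)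
      (TermDef.push (t.termDef_val .var) .var), fun v Z Z' hZ => forall₂_congr fun x hx =>
      h _ Z Z' fun i z hz => hZ i z (hz.trans_le (hb.monotone fun j => ?_))⟩
    cases j with
    | zero => exact hx.le
    | succ j => exact le_rfl

/-- A forcing condition: a partial function from `M` to truth values, given by its domain `dom` and
a set `val`, both in the model, such that each column has been decided almost everywhere according
to `D`, or has been left open almost everywhere. -/
structure Condition (S : Set (Set M)) (D : Set M) where
  val : Set M
  dom : Set M
  val_mem : val ∈ S
  dom_mem : dom ∈ S
  column : ∀ x, (∃ s₀, ∀ s, s₀ ≤ s → pair x s ∈ dom ∧ (pair x s ∈ val ↔ x ∈ D)) ∨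
    ∃ s₀, ∀ s, s₀ ≤ s → pair x s ∉ dom

namespace Condition

variable {S : Set (Set M)} {D : Set M}

instance : Preorder (Condition S D) where
  le p q := ∀ z ∈ p.dom, z ∈ q.dom ∧ (z ∈ p.val ↔ z ∈ q.val)
  le_refl p z hz := ⟨hz, Iff.rfl⟩
  le_trans p q r hpq hqr z hz := ⟨(hqr z (hpq z hz).1).1, (hpq z hz).2.trans (hqr z (hpq z hz).1).2⟩

/-- `B` extends the partial function `p`. -/
def Agrees (p : Condition S D) (B : Set M) : Prop := ∀ z ∈ p.dom, z ∈ B ↔ z ∈ p.val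

theorem Agrees.mono {p q : Condition S D} {B : Set M} (hq : q.Agrees B) (hpq : p ≤ q) :
    p.Agrees B :=
  fun z hz => (hq z (hpq z hz).1).trans (hpq z hz).2.symm

variable [Countable M] (hM : RCA0 S) (hS : S.Countable)
include hM hS

/-- Only points below `n` change, and `s ≤ ⟨x, s⟩`, so the tail of every column is untouched. -/
theorem exists_le_initial (p : Condition S D) {T : Set M} (hT : T ∈ S) (n : M)
    (h : ∀ z, z < n → z ∈ p.dom → (z ∈ T ↔ z ∈ p.val)) :
    ∃ q, p ≤ q ∧ ∀ z, z < n → z ∈ q.dom ∧ (z ∈ q.val ↔ z ∈ T) := by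
  have := Fact.mk hT
  have := Fact.mk p.val_mem
  have := Fact.mk p.dom_mem
  refine ⟨⟨{z | (z < n ∧ z ∈ T) ∨ (n ≤ z ∧ z ∈ p.val)}, {z | z < n ∨ z ∈ p.dom},
    hM.mem_of_boundedDef hS ?_, hM.mem_of_boundedDef hS ?_, fun x => ?_⟩, fun z hz => ?_,
    fun z hz => ?_⟩
  · exact inferInstanceAs (BoundedDef S fun u => (u 0 < n ∧ u 0 ∈ T) ∨ (n ≤ u 0 ∧ u 0 ∈ p.val))
  · exact inferInstanceAs (BoundedDef S fun u => u 0 < n ∨ u 0 ∈ p.dom)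
  · rcases p.column x with ⟨s₀, hs⟩ | ⟨s₀, hs⟩
    · refine .inl ⟨max s₀ n, fun s hs' => ?_⟩
      have h1 := hs s (le_of_max_le_left hs')
      have h2 : n ≤ pair x s := (le_of_max_le_right hs').trans (le_pair_right x s)
      exact ⟨.inr h1.1, by simpa [h2, h2.not_gt] using h1.2⟩
    · refine .inr ⟨max s₀ n, fun s hs' => ?_⟩
      have h1 := hs s (le_of_max_le_left hs')
      have h2 : n ≤ pair x s := (le_of_max_le_right hs').trans (le_pair_right x s)
      simp [h1, h2]
  · refine ⟨.inr hz, ?_⟩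
    rcases lt_or_ge z n with h1 | h1
    · simp [h1, h1.not_ge, h z h1 hz]
    · simp [h1, h1.not_gt]
  · exact ⟨.inl hz, by simp [hz, hz.not_ge]⟩

theorem exists_le_column (p : Condition S D) (x : M) :
    ∃ q, p ≤ q ∧ ∃ s₀, ∀ s, s₀ ≤ s → pair x s ∈ q.dom ∧ (pair x s ∈ q.val ↔ x ∈ D) := by
  rcases p.column x with h | ⟨s₀, hs⟩
  · exact ⟨p, le_rfl, h⟩
  have := Fact.mk p.val_mem
  have := Fact.mk p.dom_mem
  have hcol : ∀ z, (∃ s, s < z + 1 ∧ z = pair x s) ↔ ∃ s, z = pair x s := fun z =>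
    ⟨fun ⟨s, h⟩ => ⟨s, h.2⟩, fun ⟨s, h⟩ => ⟨s, lt_add_one_iff_le.2 (h ▸ le_pair_right x s), h⟩⟩
  -- The one bit of `D` that is needed becomes a number parameter, so the new condition is definable
  -- over `S`.
  obtain ⟨c, hc⟩ : ∃ c : M, c = 0 ↔ x ∈ D := by
    by_cases hx : x ∈ D
    · exact ⟨0, by simp [hx]⟩
    · exact ⟨1, by simp [hx]⟩
  have hx₀ : ∀ s, s₀ ≤ s → pair x s ∈ {z | z ∈ p.dom ∨ ∃ s, s < z + 1 ∧ z = pair x s} ∧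
      (pair x s ∈ {z | (z ∈ p.dom ∧ z ∈ p.val) ∨ (z ∉ p.dom ∧ c = 0)} ↔ x ∈ D) :=
    fun s h => ⟨.inr ((hcol _).2 ⟨s, rfl⟩), by simp [hs s h, hc]⟩
  refine ⟨⟨{z | (z ∈ p.dom ∧ z ∈ p.val) ∨ (z ∉ p.dom ∧ c = 0)},
    {z | z ∈ p.dom ∨ ∃ s, s < z + 1 ∧ z = pair x s}, hM.mem_of_boundedDef hS ?_,
    hM.mem_of_boundedDef hS ?_, fun x' => ?_⟩, fun z hz => ⟨.inl hz, by simp [hz]⟩, s₀, hx₀⟩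
  · exact inferInstanceAs (BoundedDef S fun u =>
      (u 0 ∈ p.dom ∧ u 0 ∈ p.val) ∨ (¬ u 0 ∈ p.dom ∧ c = 0))
  · exact inferInstanceAs (BoundedDef S fun u =>
      u 0 ∈ p.dom ∨ ∃ s, s < u 0 + 1 ∧ u 0 = pair x s)
  · by_cases hx : x' = x
    · subst hx
      exact .inl ⟨s₀, hx₀⟩
    · rcases p.column x' with ⟨s₁, hs₁⟩ | ⟨s₁, hs₁⟩
      · exact .inl ⟨s₁, fun s h => ⟨.inl (hs₁ s h).1, by simpa [(hs₁ s h).1] using (hs₁ s h).2⟩⟩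
      · refine .inr ⟨s₁, fun s h => ?_⟩
        rintro (h' | h')
        · exact hs₁ s h h'
        · obtain ⟨s', h'⟩ := (hcol _).1 h'
          exact hx (pair_inj.1 h').1

/-- `none` stands for the generic set. That some finite string compatible with `p` makes `∃ y φ`
true for all `x < m` is a `Σ₁` property of `m` over `S`. If it holds at `a + 1`, such a string
settles the conclusion. Otherwise it holds at some `m` and fails at `m + 1`; a string for `m` then
forces `∃ y φ` below `m`, while truth at `m` would make an initial segment of `B` a string for `m +
1`. So the base case or the induction step fails for `B`. -/
theorem exists_le_induction (p : Condition S D) {k : ℕ} (φ : Form0 k) (Z : Fin k → Option S)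
    (v : ℕ → M) (a : M) :
    ∃ q, p ≤ q ∧ ∀ B : Set M, q.Agrees B →
      (∀ n, ∃ c d, ∀ z, z < n → (z ∈ B ↔ z ∈ codedSet c d n)) →
      (∃ y, φ.Sat (fun i => (Z i).elim B Subtype.val) (push y (push 0 v))) →
      (∀ x, (∃ y, φ.Sat (fun i => (Z i).elim B Subtype.val) (push y (push x v))) →
        ∃ y, φ.Sat (fun i => (Z i).elim B Subtype.val) (push y (push (x + 1) v))) →
      ∃ y, φ.Sat (fun i => (Z i).elim B Subtype.val) (push y (push a v)) := by
  obtain ⟨b, hb, huse⟩ := φ.exists_use (M := M)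
  have huse : ∀ (B B' : Set M) (n x y : M), b (push y (push x v)) ≤ n →
      (∀ z, z < n → (z ∈ B ↔ z ∈ B')) →
      φ.Sat (fun i => (Z i).elim B Subtype.val) (push y (push x v)) →
      φ.Sat (fun i => (Z i).elim B' Subtype.val) (push y (push x v)) := by
    intro B B' n x y hn h
    refine (huse _ _ _ fun i z hz => ?_).1
    cases Z i with
    | none => exact h z (hz.trans_le hn)
    | some A => exact Iff.rfl
  obtain ⟨F, hF⟩ : ∃ F : M → M → M → M → M → Prop, ∀ c d n x y, F c d n x y ↔
      b (push y (push x v)) ≤ n ∧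
        φ.Sat (fun i => (Z i).elim (codedSet c d n) Subtype.val) (push y (push x v)) :=
    ⟨_, fun _ _ _ _ _ => Iff.rfl⟩
  have hv : ∀ (x y : (ℕ → M) → M) [TermDef x] [TermDef y] (i : ℕ),
      TermDef fun u => push (y u) (push (x u) v) i := fun x y _ _ =>
    TermDef.push (r := fun i u => push (x u) v i) inferInstance
      (TermDef.push (r := fun i _ => v i) inferInstance fun i => .const (v i))
  have hFdef : ∀ (c d n x y : (ℕ → M) → M) [TermDef c] [TermDef d] [TermDef n] [TermDef x]
      [TermDef y], BoundedDef S fun u => F (c u) (d u) (n u) (x u) (y u) := by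
    intro c d n x y hc hd hn hx hy
    have h1 : TermDef fun u => b (push (y u) (push (x u) v)) := hb.subst (hv x y)
    have h2 : BoundedDef S fun u => φ.Sat
        (fun i => (Z i).elim (codedSet (c u) (d u) (n u)) Subtype.val)
        (push (y u) (push (x u) v)) := by
      refine BoundedDef.sat φ
        (Z := fun u i => (Z i).elim (codedSet (c u) (d u) (n u)) Subtype.val)
        (r := fun i u => push (y u) (push (x u) v) i) (fun i => ?_) (hv x y)
      cases Z i with
      | none =>
        have hc : TermDef fun u => c fun i => u (i + 1) := hc.subst fun i => .var (i + 1)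
        have hd : TermDef fun u => d fun i => u (i + 1) := hd.subst fun i => .var (i + 1)
        have hn : TermDef fun u => n fun i => u (i + 1) := hn.subst fun i => .var (i + 1)
        exact inferInstanceAs (BoundedDef S fun u => u 0 ∈ codedSet (c fun i => u (i + 1))
          (d fun i => u (i + 1)) (n fun i => u (i + 1)))
      | some A => exact .mem A.2 (.var 0)
    exact BoundedDef.congr (P := fun u => b (push (y u) (push (x u) v)) ≤ n u ∧ φ.Sat
        (fun i => (Z i).elim (codedSet (c u) (d u) (n u)) Subtype.val)
        (push (y u) (push (x u) v))) inferInstance fun u => hF _ _ _ _ _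
  have := Fact.mk p.val_mem
  have := Fact.mk p.dom_mem
  -- The single number `w` bounds the code of the string, its length and all witnesses `y`.
  obtain ⟨R, hR⟩ : ∃ R : M → M → Prop, ∀ w m, R w m ↔
      ∃ c, c < w ∧ ∃ d, d < w ∧ ∃ n, n < w ∧
        (∀ z, z < n → z ∈ p.dom → (z ∈ codedSet c d n ↔ z ∈ p.val)) ∧
        ∀ x, x < m → ∃ y, y < w ∧ F c d n x y := ⟨_, fun _ _ => Iff.rfl⟩
  have hRdef : BoundedDef S fun u => R (u 0) (u 1) := by
    simp only [hR]
    infer_instance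
  have hext : ∀ w m, R w m → ∃ q, p ≤ q ∧ ∃ c d n, (∀ z, z < n → z ∈ q.dom ∧
      (z ∈ q.val ↔ z ∈ codedSet c d n)) ∧ ∀ x, x < m → ∃ y, y < w ∧ F c d n x y := by
    intro w m h
    obtain ⟨c, -, d, -, n, -, h1, h2⟩ := (hR w m).1 h
    have hT : codedSet c d n ∈ S := hM.mem_of_boundedDef hS
      (inferInstanceAs (BoundedDef S fun u => u 0 ∈ codedSet c d n))
    obtain ⟨q, hpq, hq⟩ := p.exists_le_initial hM hS hT n h1
    exact ⟨q, hpq, c, d, n, hq, h2⟩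
  by_cases ha : ∃ w, R w (a + 1)
  · obtain ⟨w, hw⟩ := ha
    obtain ⟨q, hpq, c, d, n, hq, h⟩ := hext w _ hw
    refine ⟨q, hpq, fun B hB _ _ _ => ?_⟩
    obtain ⟨y, -, hy⟩ := h a (lt_add_one a)
    obtain ⟨hy₁, hy₂⟩ := (hF _ _ _ _ _).1 hy
    exact ⟨y, huse _ _ n a y hy₁
      (fun z hz => ((hB z (hq z hz).1).trans (hq z hz).2).symm) hy₂⟩
  obtain ⟨m, ⟨w, hw⟩, hm⟩ : ∃ m, (∃ w, R w m) ∧ ¬ ∃ w, R w (m + 1) := by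
    by_contra! h
    refine ha ((hM.sigmaOneInduction hS).bounded hRdef ⟨1, ?_⟩ (fun x hx => ?_) (a + 1))
    · exact (hR _ _).2 ⟨0, one_pos, 0, one_pos, 0, one_pos, fun z hz => absurd hz zero_le.not_gt,
        fun z hz => absurd hz zero_le.not_gt⟩
    · exact h x hx
  obtain ⟨q, hpq, c, d, n, hq, h⟩ := hext w _ hw
  refine ⟨q, hpq, fun B hB hcode h0 hsucc => ?_⟩
  exfalso
  have hlt : ∀ x, x < m → ∃ y, φ.Sat (fun i => (Z i).elim B Subtype.val) (push y (push x v)) := by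
    intro x hx
    obtain ⟨y, -, hy⟩ := h x hx
    obtain ⟨hy₁, hy₂⟩ := (hF _ _ _ _ _).1 hy
    exact ⟨y, huse _ _ n x y hy₁
      (fun z hz => ((hB z (hq z hz).1).trans (hq z hz).2).symm) hy₂⟩
  have hfalse : ¬ ∃ y, φ.Sat (fun i => (Z i).elim B Subtype.val) (push y (push m v)) := by
    rintro ⟨y, hy⟩
    -- Long enough to contain the old string and the use of the new witness.
    obtain ⟨N, hN⟩ : ∃ N, N = max n (b (push y (push m v))) := ⟨_, rfl⟩
    have hnN : n ≤ N := hN ▸ le_max_left _ _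
    obtain ⟨c', d', hcd⟩ := hcode N
    refine hm ⟨max w (max (max c' d') (max N y) + 1), (hR _ _).2 ⟨c', ?_, d', ?_, N, ?_, ?_, ?_⟩⟩
    · exact lt_max_of_lt_right (lt_add_one_iff_le.2 (by simp))
    · exact lt_max_of_lt_right (lt_add_one_iff_le.2 (by simp))
    · exact lt_max_of_lt_right (lt_add_one_iff_le.2 (by simp))
    · exact fun z hz hzp => (hcd z hz).symm.trans (hB.mono hpq z hzp)
    · intro x hx
      rcases lt_add_one_iff_lt_or_eq.1 hx with hx | rfl
      · obtain ⟨y', hy'w, hy'⟩ := h x hx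
        obtain ⟨hy₁, hy₂⟩ := (hF _ _ _ _ _).1 hy'
        refine ⟨y', lt_max_of_lt_left hy'w, (hF _ _ _ _ _).2 ⟨hy₁.trans hnN,
          huse _ _ n x y' hy₁ (fun z hz => ?_) hy₂⟩⟩
        rw [← hcd z (hz.trans_le hnN), hB z (hq z hz).1, (hq z hz).2]
      · have hbN : b (push y (push x v)) ≤ N := hN ▸ le_max_right _ _
        exact ⟨y, lt_max_of_lt_right (lt_add_one_iff_le.2 (by simp)), (hF _ _ _ _ _).2
          ⟨hbN, huse _ _ N x y hbN hcd hy⟩⟩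
  rcases eq_or_lt_of_le (zero_le (a := m)) with rfl | hm0
  · exact hfalse h0
  · obtain ⟨x, rfl⟩ := exists_eq_add_one hm0
    exact hfalse (hsucc x (hlt x (lt_add_one x)))

end Condition

/-- Over a countable model of `RCA₀`, any set is the pointwise limit of a set that preserves `Σ₁`
induction. -/
theorem exists_limit_preserving_induction [Countable M] {S : Set (Set M)} (hM : RCA0 S)
    (hS : S.Countable) (D : Set M) :
    ∃ B : Set M, SigmaOneInduction (insert B S) ∧
      ∀ x, ∃ s₀, ∀ s, s₀ ≤ s → (pair x s ∈ B ↔ x ∈ D) := by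
  obtain ⟨v, hv⟩ := exists_surjective_nat M
  have := hS.to_subtype
  obtain ⟨f, hf⟩ := exists_surjective_nat (Option S)
  -- Requirements: decide all points below `n`, settle column `x`, meet induction for `φ` up to `a`.
  -- The parameters come from `v` and `f`.
  let ι := M ⊕ M ⊕ ((Σ k, Form0 k) × M)
  have : Encodable ι := Encodable.ofCountable ι
  have hempty : (∅ : Set M) ∈ S := hM.mem_of_boundedDef hS
    (BoundedDef.congr (.lt (.var 0) (.const 0)) fun u => by simp)
  let p₀ : Condition S D := ⟨∅, ∅, hempty, hempty, fun x => .inr ⟨0, fun s _ => by simp⟩⟩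
  let 𝒟 : ι → Order.Cofinal (Condition S D)
    | .inl n => ⟨{q | ∀ z, z < n → z ∈ q.dom}, fun p => by
        obtain ⟨q, hpq, hq⟩ := p.exists_le_initial hM hS p.val_mem n fun _ _ _ => Iff.rfl
        exact ⟨q, fun z hz => (hq z hz).1, hpq⟩⟩
    | .inr (.inl x) => ⟨{q | ∃ s₀, ∀ s, s₀ ≤ s → pair x s ∈ q.dom ∧ (pair x s ∈ q.val ↔ x ∈ D)},
        fun p => by
          obtain ⟨q, hpq, hq⟩ := p.exists_le_column hM hS x
          exact ⟨q, hq, hpq⟩⟩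
    | .inr (.inr (⟨k, φ⟩, a)) => ⟨_, fun p => by
        obtain ⟨q, hpq, hq⟩ := p.exists_le_induction hM hS φ (fun i => f i) v a
        exact ⟨q, hq, hpq⟩⟩
  let I := Order.idealOfCofinals p₀ 𝒟
  let B : Set M := {z | ∃ p ∈ I, z ∈ p.dom ∧ z ∈ p.val}
  have hB : ∀ p ∈ I, p.Agrees B := by
    intro p hp z hz
    refine ⟨fun ⟨q, hq, hzq⟩ => ?_, fun h => ⟨p, hp, hz, h⟩⟩
    obtain ⟨r, -, hpr, hqr⟩ := I.directed p hp q hq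
    exact (hpr z hz).2.2 ((hqr z hzq.1).2.1 hzq.2)
  have hcode : ∀ n, ∃ c d, ∀ z, z < n → (z ∈ B ↔ z ∈ codedSet c d n) := by
    intro n
    obtain ⟨q, hq, hqI⟩ := Order.cofinal_meets_idealOfCofinals p₀ 𝒟 (.inl n)
    have hq : ∀ z, z < n → z ∈ q.dom := hq
    obtain ⟨c, d, h⟩ := exists_codedSet_eq (hM.sigmaOneInduction hS)
      (.mem q.val_mem (.var 0)) n
    exact ⟨c, d, fun z hz => by rw [hB q hqI z (hq z hz), h, and_iff_right hz]⟩
  refine ⟨B, fun P hP h0 hs a => ?_, fun x => ?_⟩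
  · obtain ⟨k, hk⟩ := hP.exists_form hv (E := fun i => (f i).elim B Subtype.val) (by
      rintro X (rfl | hX)
      · exact (hf none).imp fun i hi => by rw [hi]; rfl
      · exact (hf (some ⟨X, hX⟩)).imp fun i hi => by rw [hi]; rfl)
    obtain ⟨φ, hφ⟩ := hk k le_rfl
    obtain ⟨q, hq, hqI⟩ := Order.cofinal_meets_idealOfCofinals p₀ 𝒟 (.inr (.inr (⟨k, φ⟩, a)))
    have := hq B (hB q hqI) hcode
    simp only [← hφ] at this
    exact this h0 hs
  · obtain ⟨q, ⟨s₀, hq⟩, hqI⟩ := Order.cofinal_meets_idealOfCofinals p₀ 𝒟 (.inr (.inl x))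
    exact ⟨s₀, fun s h => (hB q hqI _ (hq s h).1).trans (hq s h).2⟩

end

/-! ### Computations and the jump. -/

section

variable {M : Type*} [CommSemiring M] [LinearOrder M] [PMinus M]

section Justified

variable {A T : Set M} {f g x y c : M}

theorem justified_const : Justified A T (pair 0 c) x y ↔ y = c := by
  simp [Justified, pair_inj, eq_comm]

theorem justified_snd : Justified A T (pair 3 0) x y ↔ ∃ a, x = pair a y := by
  simp [Justified, pair_inj]

theorem justified_add :
    Justified A T (pair 4 0) x y ↔ ∃ a b, x = pair a b ∧ y = a + b := by
  simp [Justified, pair_inj]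

theorem justified_oracle :
    Justified A T (pair 7 0) x y ↔ (x ∈ A ∧ y = 1) ∨ (x ∉ A ∧ y = 0) := by
  simp [Justified, pair_inj]

theorem justified_pair : Justified A T (pair 8 (pair f g)) x y ↔
    ∃ u w, Rec T f x u ∧ Rec T g x w ∧ y = pair u w := by
  simp [Justified, pair_inj]

theorem justified_comp : Justified A T (pair 9 (pair f g)) x y ↔
    ∃ u, Rec T g x u ∧ Rec T f u y := by
  simp [Justified, pair_inj]

theorem justified_mu : Justified A T (pair 10 f) x y ↔
    Rec T f (pair x y) 0 ∧ ∀ z, z < y → ∃ w, w ≠ 0 ∧ Rec T f (pair x z) w := by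
  simp [Justified, pair_inj]

end Justified

/-- A bounded definable family of computation records is coded, hence witnesses a computation. -/
theorem computes_of_records {𝒵 : Set (Set M)} (hI : SigmaOneInduction 𝒵) {A : Set M}
    {V : M → M → M → Prop} [BoundedDef 𝒵 fun u => V (u 2) (u 1) (u 0)] {N : M}
    (hN : ∀ e x y, V e x y → pair e (pair x y) ≤ N)
    (hJ : ∀ T, (∀ e x y, Rec T e x y ↔ V e x y) → ∀ e x y, V e x y → Justified A T e x y)
    {e x y : M} (h : V e x y) : Computes A e x y := by
  have hX : BoundedDef 𝒵 fun u => u 0 ∈ {t | ∃ e, e < N + 1 ∧ ∃ x, x < N + 1 ∧ ∃ y, y < N + 1 ∧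
      t = pair e (pair x y) ∧ V e x y} :=
    inferInstanceAs (BoundedDef 𝒵 fun u => ∃ e, e < N + 1 ∧ ∃ x, x < N + 1 ∧ ∃ y, y < N + 1 ∧
      u 0 = pair e (pair x y) ∧ V e x y)
  obtain ⟨a, b, hab⟩ := exists_codedSet_eq hI hX (N + 1)
  have hrec : ∀ e x y, Rec (codedSet a b (N + 1)) e x y ↔ V e x y := by
    intro e x y
    rw [Rec, hab]
    constructor
    · rintro ⟨-, e', -, x', -, y', -, h, hV⟩
      obtain ⟨rfl, h'⟩ := pair_inj.1 h
      obtain ⟨rfl, rfl⟩ := pair_inj.1 h'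
      exact hV
    · intro hV
      have h1 := hN e x y hV
      have h2 : pair x y ≤ N := (le_pair_right _ _).trans h1
      exact ⟨lt_add_one_iff_le.2 h1, e, lt_add_one_iff_le.2 ((le_pair_left _ _).trans h1), x,
        lt_add_one_iff_le.2 ((le_pair_left _ _).trans h2), y,
        lt_add_one_iff_le.2 ((le_pair_right _ _).trans h2), rfl, hV⟩
  exact ⟨a, b, N + 1, (hrec _ _ _).2 h, fun e x y h => hJ _ hrec e x y ((hrec _ _ _).1 h)⟩

/-- The program that searches, on any input, for the least `s` such that `⟨x, s₀ + s⟩` is not in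
the oracle. -/
def searchProgram (x s₀ : M) : M :=
  pair 10 (pair 9 (pair (pair 7 0) (pair 8 (pair (pair 0 x)
    (pair 9 (pair (pair 4 0) (pair 8 (pair (pair 0 s₀) (pair 3 0)))))))))

/-- The program is a polynomial in its parameters, so no parameter theorem is needed. -/
instance {x s : (ℕ → M) → M} [TermDef x] [TermDef s] :
    TermDef fun u => searchProgram (x u) (s u) := by
  unfold searchProgram; infer_instance

/-- The program has fixed standard depth, so unwinding its records needs no induction. -/
theorem exists_notMem_of_searchProgram_mem_jump {B : Set M} {x s₀ : M}
    (h : searchProgram x s₀ ∈ jump B) : ∃ s, pair x (s₀ + s) ∉ B := by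
  obtain ⟨y, a, b, n, h, hJ⟩ := h
  refine ⟨y, ?_⟩
  have h1 := (justified_mu.1 (hJ _ _ _ h)).1
  obtain ⟨u, hg, hu⟩ := justified_comp.1 (hJ _ _ _ h1)
  obtain ⟨x', w, hx', hw, rfl⟩ := justified_pair.1 (hJ _ _ _ hg)
  obtain rfl := justified_const.1 (hJ _ _ _ hx')
  obtain ⟨t, ht, hw⟩ := justified_comp.1 (hJ _ _ _ hw)
  obtain ⟨s', y', hs', hy', rfl⟩ := justified_pair.1 (hJ _ _ _ ht)
  obtain rfl := justified_const.1 (hJ _ _ _ hs')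
  obtain ⟨c, hc⟩ := justified_snd.1 (hJ _ _ _ hy')
  obtain ⟨-, rfl⟩ := pair_inj.1 hc
  obtain ⟨p, q, hpq, rfl⟩ := justified_add.1 (hJ _ _ _ hw)
  obtain ⟨rfl, rfl⟩ := pair_inj.1 hpq
  rcases justified_oracle.1 (hJ _ _ _ hu) with h | h
  · exact absurd h.2 zero_ne_one
  · exact h.1

set_option synthInstance.maxHeartbeats 400000 in
set_option synthInstance.maxSize 1024 in
theorem searchProgram_mem_jump {𝒵 : Set (Set M)} (hI : SigmaOneInduction 𝒵) {B : Set M}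
    (hB : B ∈ 𝒵) {x s₀ s : M} (hs : pair x (s₀ + s) ∉ B) : searchProgram x s₀ ∈ jump B := by
  have := Fact.mk hB
  obtain ⟨y, hy, hmin⟩ := hI.least (R := fun s => ¬ pair x (s₀ + s) ∈ B) (by infer_instance) hs
  simp only [not_not] at hmin
  obtain ⟨k, hk⟩ : ∃ k, k = pair 8 (pair (pair 0 s₀) (pair 3 0)) := ⟨_, rfl⟩
  obtain ⟨h, hh⟩ : ∃ h, h = pair 9 (pair (pair 4 0) k) := ⟨_, rfl⟩
  obtain ⟨g, hg⟩ : ∃ g, g = pair 8 (pair (pair 0 x) h) := ⟨_, rfl⟩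
  obtain ⟨f, hf⟩ : ∃ f, f = pair 9 (pair (pair 7 0) g) := ⟨_, rfl⟩
  obtain ⟨e, he⟩ : ∃ e, e = pair 10 f := ⟨_, rfl⟩
  have hse : searchProgram x s₀ = e := by rw [he, hf, hg, hh, hk]; rfl
  rw [hse]
  -- All records of the run with the least solution `y`; `c` is the oracle's answer at stage `z`,
  -- which is `1` before `y` and `0` at `y`.
  let V : M → M → M → Prop := fun p i o => (p = e ∧ i = e ∧ o = y) ∨
    ∃ z, z < y + 1 ∧ ∃ c, c < 1 + 1 ∧ ((z < y ∧ c = 1) ∨ (z = y ∧ c = 0)) ∧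
      ((p = f ∧ i = pair e z ∧ o = c) ∨ (p = pair 7 0 ∧ i = pair x (s₀ + z) ∧ o = c) ∨
      (p = g ∧ i = pair e z ∧ o = pair x (s₀ + z)) ∨ (p = pair 0 x ∧ i = pair e z ∧ o = x) ∨
      (p = h ∧ i = pair e z ∧ o = s₀ + z) ∨ (p = pair 4 0 ∧ i = pair s₀ z ∧ o = s₀ + z) ∨
      (p = k ∧ i = pair e z ∧ o = pair s₀ z) ∨ (p = pair 0 s₀ ∧ i = pair e z ∧ o = s₀) ∨
      (p = pair 3 0 ∧ i = pair e z ∧ o = z))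
  have hVdef : BoundedDef 𝒵 fun u => V (u 2) (u 1) (u 0) := by
    simp only [V]; infer_instance
  -- Pairing is monotone, so the cases `z = y`, `c = 1` dominate all records.
  obtain ⟨N, hN⟩ := (Set.toFinite {pair e (pair e y), pair f (pair (pair e y) 1),
    pair (pair 7 0) (pair (pair x (s₀ + y)) 1), pair g (pair (pair e y) (pair x (s₀ + y))),
    pair (pair 0 x) (pair (pair e y) x), pair h (pair (pair e y) (s₀ + y)),
    pair (pair 4 0) (pair (pair s₀ y) (s₀ + y)), pair k (pair (pair e y) (pair s₀ y)),
    pair (pair 0 s₀) (pair (pair e y) s₀), pair (pair 3 0) (pair (pair e y) y)}).bddAbove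
  refine ⟨y, computes_of_records hI (V := V) (N := N) ?_ ?_ (.inl ⟨rfl, rfl, rfl⟩)⟩
  · have hle : ∀ {p i i' o o' : M}, pair p (pair i' o') ≤ N → i ≤ i' → o ≤ o' →
        pair p (pair i o) ≤ N :=
      fun h hi ho => (pair_mono le_rfl (pair_mono hi ho)).trans h
    rintro p i o (⟨rfl, rfl, rfl⟩ | ⟨z, hz, c, hc, -, hV⟩)
    · exact hN (by simp)
    have hz := lt_add_one_iff_le.1 hz
    have hc := lt_add_one_iff_le.1 hc
    have hez : pair e z ≤ pair e y := pair_mono le_rfl hz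
    have hsz : pair s₀ z ≤ pair s₀ y := pair_mono le_rfl hz
    have hsz' : s₀ + z ≤ s₀ + y := add_le_add le_rfl hz
    have hxz : pair x (s₀ + z) ≤ pair x (s₀ + y) := pair_mono le_rfl hsz'
    rcases hV with ⟨rfl, rfl, rfl⟩ | ⟨rfl, rfl, rfl⟩ | ⟨rfl, rfl, rfl⟩ | ⟨rfl, rfl, rfl⟩ |
      ⟨rfl, rfl, rfl⟩ | ⟨rfl, rfl, rfl⟩ | ⟨rfl, rfl, rfl⟩ | ⟨rfl, rfl, rfl⟩ | ⟨rfl, rfl, rfl⟩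
    · exact hle (hN (by simp)) hez hc
    · exact hle (hN (by simp)) hxz hc
    · exact hle (hN (by simp)) hez hxz
    · exact hle (hN (by simp)) hez le_rfl
    · exact hle (hN (by simp)) hez hsz'
    · exact hle (hN (by simp)) hsz hsz'
    · exact hle (hN (by simp)) hez hsz
    · exact hle (hN (by simp)) hez le_rfl
    · exact hle (hN (by simp)) hez hz
  · rintro T hT p i o (⟨hp, hi, ho⟩ | ⟨z, hz, c, hc, hzc, hV⟩)
    · have hf' : ∀ z, z < y + 1 → ∀ c, c < 1 + 1 → ((z < y ∧ c = 1) ∨ (z = y ∧ c = 0)) →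
          Rec T f (pair e z) c := fun z hz c hc hzc =>
        (hT _ _ _).2 (.inr ⟨z, hz, c, hc, hzc, .inl ⟨rfl, rfl, rfl⟩⟩)
      rw [hp, hi, ho]
      conv => arg 3; rw [he]
      rw [justified_mu]
      refine ⟨hf' _ (lt_add_one _) _ (by positivity) (.inr ⟨rfl, rfl⟩), fun z hz => ⟨1,
        one_ne_zero, hf' z (hz.trans (lt_add_one _)) 1 (lt_add_one 1) (.inl ⟨hz, rfl⟩)⟩⟩
    have key : ∀ p i o, _ → Rec T p i o := fun p i o h =>
      (hT p i o).2 (.inr ⟨z, hz, c, hc, hzc, h⟩)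
    rcases hV with ⟨rfl, rfl, rfl⟩ | ⟨rfl, rfl, rfl⟩ | ⟨rfl, rfl, rfl⟩ | ⟨rfl, rfl, rfl⟩ |
      ⟨rfl, rfl, rfl⟩ | ⟨rfl, rfl, rfl⟩ | ⟨rfl, rfl, rfl⟩ | ⟨rfl, rfl, rfl⟩ | ⟨rfl, rfl, rfl⟩
    · conv => arg 3; rw [hf]
      exact justified_comp.2 ⟨pair x (s₀ + z), key _ _ _ (by simp), key _ _ _ (by simp)⟩
    · rw [justified_oracle]
      rcases hzc with ⟨hzy, rfl⟩ | ⟨rfl, rfl⟩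
      · exact .inl ⟨hmin z hzy, rfl⟩
      · exact .inr ⟨hy, rfl⟩
    · conv => arg 3; rw [hg]
      exact justified_pair.2 ⟨x, s₀ + z, key _ _ _ (by simp), key _ _ _ (by simp), rfl⟩
    · exact justified_const.2 rfl
    · conv => arg 3; rw [hh]
      exact justified_comp.2 ⟨pair s₀ z, key _ _ _ (by simp), key _ _ _ (by simp)⟩
    · exact justified_add.2 ⟨s₀, z, rfl, rfl⟩
    · conv => arg 3; rw [hk]
      exact justified_pair.2 ⟨s₀, z, key _ _ _ (by simp), key _ _ _ (by simp), rfl⟩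
    · exact justified_const.2 rfl
    · exact justified_snd.2 ⟨e, rfl⟩

end

end SecondOrderArith

theorem mainTheorem4 {M : Type*} [CommSemiring M] [LinearOrder M] [SecondOrderArith.PMinus M]
    [Countable M] (S : Set (Set M)) (hS : S.Countable) (hM : SecondOrderArith.RCA0 S)
    (C : Set M) :
    ∃ B : Set M, SecondOrderArith.RCA0 (SecondOrderArith.ext S B) ∧
      SecondOrderArith.IsDeltaIn 2 B C ∧
      SecondOrderArith.IsDeltaIn 1 (SecondOrderArith.jump B) C := by
  open SecondOrderArith in
  -- Coding `C` together with its complement means that only the existential form of the limit is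
  -- ever needed.
  obtain ⟨B, hI, hB⟩ := exists_limit_preserving_induction hM hS (join C Cᶜ)
  have hlim : ∀ x, x ∈ join C Cᶜ ↔ ∃ s₀, ∀ s, s₀ ≤ s → pair x s ∈ B := by
    intro x
    obtain ⟨s₀, hs⟩ := hB x
    refine ⟨fun hx => ⟨s₀, fun s h => (hs s h).2 hx⟩, fun ⟨s₁, h⟩ => ?_⟩
    exact (hs (max s₀ s₁) (le_max_left _ _)).1 (h _ (le_max_right _ _))
  have hjump : ∀ x, x ∈ join C Cᶜ ↔ ∃ s₀, ¬ searchProgram x s₀ ∈ jump B := by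
    intro x
    rw [hlim]
    refine exists_congr fun s₀ => ⟨fun h h' => ?_, fun h s hs => ?_⟩
    · obtain ⟨s, hs⟩ := exists_notMem_of_searchProgram_mem_jump h'
      exact hs (h _ le_self_add)
    · obtain ⟨s, rfl⟩ := exists_add_of_le hs
      by_contra h'
      exact h (searchProgram_mem_jump hI (.inl rfl) h')
  have hBB : Fact (B ∈ ({B} : Set (Set M))) := ⟨rfl⟩
  have hJJ : Fact (jump B ∈ ({jump B} : Set (Set M))) := ⟨rfl⟩
  have hC : ∀ x, x ∈ C ↔ 2 * x ∈ join C Cᶜ := fun x => two_mul_mem_join.symm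
  have hC' : ∀ x, x ∈ Cᶜ ↔ 2 * x + 1 ∈ join C Cᶜ := fun x => two_mul_add_one_mem_join.symm
  refine ⟨B, rca0_ext hI, ⟨?_, ?_⟩, isDeltaIn_one_of_sigmaOneDef ?_ ?_⟩
  · exact isSigma_two_of_boundedDef (R := fun s s₀ x => s₀ ≤ s → pair (2 * x) s ∈ B)
      (by infer_instance) fun x => (hC x).trans (hlim _)
  · exact isSigma_two_of_boundedDef (R := fun s s₀ x => s₀ ≤ s → pair (2 * x + 1) s ∈ B)
      (by infer_instance) fun x => (hC' x).trans (hlim _)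
  · exact ⟨fun s u => ¬ searchProgram (2 * u 0) s ∈ jump B, by infer_instance,
      fun u => (hC _).trans (hjump _)⟩
  · exact ⟨fun s u => ¬ searchProgram (2 * u 0 + 1) s ∈ jump B, by infer_instance,
      fun u => (hC' _).trans (hjump _)⟩
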